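/- Let $\mathcal H=\mathbb C^d$ be a finite-dimensional Hilbert space, let $\mathcal E:\mathcal B(\mathcal H)\to\mathcal B(\mathcal H)$ be a completely positive trace-preserving (CPTP) linear map, and let $\mathcal E^\dagger$ be its adjoint, $\mathrm{Tr}(\mathcal E^\dagger(X)Y)=\mathrm{Tr}(X\mathcal E(Y))$. Assume that $\mathcal E$ has a full-rank fixed point, i.e. there is an operator $X$ of rank $d$ with $\mathcal E(X)=X$. Definitions. A state is a positive semidefinite operator of trace $1$; a code is a set of states; $\|A\|_1=\mathrm{Tr}\sqrt{A^\dagger A}$. A code $\mathcal C$ is preserved by a map $\mathcal F$ if $\|\mathcal F(p\rho-(1-p)\sigma)\|_1=\|p\rho-(1-p)\sigma\|_1$ for all $\rho,\sigma$ in the convex hull of $\mathcal C$ and all $p\in[0,1]$. It is noiseless for $\mathcal E$ if it is preserved by every convex combination $\sum_n q_n\mathcal E^n$ of powers of $\mathcal E$. Two codes $\mathcal C_1,\mathcal C_2$ are isometric if there is a linear map $f$, restricting to a bijection $\mathcal C_1\to\mathcal C_2$, with $\|pf(\rho)-(1-p)f(\sigma)\|_1=\|p\rho-(1-p)\sigma\|_1$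 for all $\rho,\sigma$ in the convex hull of $\mathcal C_1$ and all $p\in[0,1]$. A noiseless code is maximum if it is not isometric to a strict subset of a noiseless code for $\mathcal E$. Then: (1) The fixed points of $\mathcal E^\dagger$ form a unital matrix $*$-algebra $\mathcal A$, and there is a unitary identification $$\mathcal H\cong\bigoplus_k A_k\otimes B_k\quad(A_k,B_k\neq 0)\qquad\text{under which}\qquad \mathcal A=\bigoplus_k\mathcal M_{A_k}\otimes 1_{B_k}.$$ (2) For every such identification, with noiseless factors $A_k$ and noise-full factors $B_k$, a set $\mathcal C$ of operators is a maximum noiseless code for $\mathcal E$ if and only if there are states $\mu_k$ on $B_k$ such that $$\mathcal C=\Big\{\bigoplus_k p_k\,\rho_k\otimes\mu_k\ :\ p_k\ge 0,\ \sum_k p_k=1,\ \rho_k\text{ a state on }A_k\Big\}.$$ (3) Every maximum noiseless code for $\mathcal E$ is isometric to the set of states in the matrix algebra $\mathcal A$. -/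

import Mathlib

open scoped Matrix Kronecker ComplexOrder MatrixOrder CStarAlgebra Matrix.Norms.L2Operator

noncomputable section

namespace QInfo

variable {n m : Type*} [Fintype n] [DecidableEq n] [Fintype m] [DecidableEq m]

/-- A state of the system with Hilbert space `ℂⁿ`: a positive semidefinite matrix of trace `1`. -/
def IsState (ρ : Matrix n n ℂ) : Prop :=
  ρ.PosSemidef ∧ ρ.trace = 1

/-- The trace norm (`1`-norm) `‖A‖₁ = tr √(A† A)`. -/
def traceNorm (A : Matrix n n ℂ) : ℝ :=
  (CFC.sqrt (Aᴴ * A)).trace.re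

/-- A linear map on matrices is trace preserving. -/
def IsTracePreserving (E : Matrix n n ℂ →ₗ[ℂ] Matrix n n ℂ) : Prop :=
  ∀ X : Matrix n n ℂ, (E X).trace = X.trace

/-- The (Heisenberg picture) adjoint `E†` of a linear map `E` on matrices, characterized by
`tr (E†(X) Y) = tr (X E(Y))`, see `trace_adjointMap_mul`. -/
def adjointMap (E : Matrix n n ℂ →ₗ[ℂ] Matrix n n ℂ) : Matrix n n ℂ →ₗ[ℂ] Matrix n n ℂ where
  toFun X := Matrix.of fun i j => (X * E (Matrix.single j i 1)).trace
  map_add' X Y := by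
    ext i j
    simp [add_mul]
  map_smul' c X := by
    ext i j
    simp

theorem trace_adjointMap_mul (E : Matrix n n ℂ →ₗ[ℂ] Matrix n n ℂ) (X Y : Matrix n n ℂ) :
    (adjointMap E X * Y).trace = (X * E Y).trace := by
  have h : (Matrix.traceLinearMap n ℂ ℂ) ∘ₗ LinearMap.mulLeft ℂ (adjointMap E X) =
      (Matrix.traceLinearMap n ℂ ℂ) ∘ₗ LinearMap.mulLeft ℂ X ∘ₗ E := by
    apply Matrix.ext_linearMap
    intro i j
    ext
    simp [Matrix.trace_mul_single, adjointMap]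
  simpa using LinearMap.congr_fun h Y

/-- Two codes (sets of states, possibly of different systems) are (1-)isometric if a linear map
restricts to a bijection between them and preserves all weighted `1`-norm distances on the convex
closure of the first one. -/
def IsIsometric (C₁ : Set (Matrix n n ℂ)) (C₂ : Set (Matrix m m ℂ)) : Prop :=
  ∃ f : Matrix n n ℂ →ₗ[ℂ] Matrix m m ℂ, Set.BijOn f C₁ C₂ ∧
    ∀ ρ ∈ convexHull ℝ C₁, ∀ σ ∈ convexHull ℝ C₁, ∀ p ∈ Set.Icc (0 : ℝ) 1,
      traceNorm (p • f ρ - (1 - p) • f σ) = traceNorm (p • ρ - (1 - p) • σ)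

/-- The code `C` is preserved by `E`: all weighted `1`-norm distances between (mixtures of) code
states are preserved. For convex `C` the convex closure is `C` itself. -/
def IsPreserved (E : Matrix n n ℂ →ₗ[ℂ] Matrix n n ℂ) (C : Set (Matrix n n ℂ)) : Prop :=
  ∀ ρ ∈ convexHull ℝ C, ∀ σ ∈ convexHull ℝ C, ∀ p ∈ Set.Icc (0 : ℝ) 1,
    traceNorm (E (p • ρ - (1 - p) • σ)) = traceNorm (p • ρ - (1 - p) • σ)

/-- `C` is a noiseless code for `E`: a set of states that is preserved by every convex combination
of the powers of `E`. -/
def IsNoiseless (E : Matrix n n ℂ →ₗ[ℂ] Matrix n n ℂ) (C : Set (Matrix n n ℂ)) : Prop :=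
  (∀ ρ ∈ C, IsState ρ) ∧
    ∀ F ∈ convexHull ℝ (Set.range fun k : ℕ => (E : Module.End ℂ (Matrix n n ℂ)) ^ k),
      IsPreserved F C

/-- `C` is a maximum noiseless code for `E`: it is noiseless, and it is not isometric to a strict
subset of a noiseless code. -/
def IsMaximumNoiseless (E : Matrix n n ℂ →ₗ[ℂ] Matrix n n ℂ) (C : Set (Matrix n n ℂ)) : Prop :=
  IsNoiseless E C ∧
    ¬ ∃ Cbig Csmall : Set (Matrix n n ℂ),
      IsNoiseless E Cbig ∧ Csmall ⊂ Cbig ∧ IsIsometric C Csmall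

variable (n) in
/-- A unitary identification of `ℂⁿ` with `⨁ₖ Aₖ ⊗ Bₖ`, where `Aₖ = ℂ ^ dA k` and
`Bₖ = ℂ ^ dB k` are nonzero. -/
structure SectorDecomposition where
  /-- The number of sectors. -/
  K : ℕ
  /-- The dimension of the noiseless factor `Aₖ`. -/
  dA : Fin K → ℕ
  /-- The dimension of the noise-full factor `Bₖ`. -/
  dB : Fin K → ℕ
  dA_pos : ∀ k, 0 < dA k
  dB_pos : ∀ k, 0 < dB k
  /-- The unitary from `⨁ₖ Aₖ ⊗ Bₖ` to `ℂⁿ`. -/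
  U : Matrix n ((k : Fin K) × (Fin (dA k) × Fin (dB k))) ℂ
  U_mul_conjTranspose : U * Uᴴ = 1
  conjTranspose_mul_U : Uᴴ * U = 1

namespace SectorDecomposition

/-- The operator `⨁ₖ Xₖ ⊗ Yₖ` on `ℂⁿ`. -/
def directSum (D : SectorDecomposition n)
    (X : (k : Fin D.K) → Matrix (Fin (D.dA k)) (Fin (D.dA k)) ℂ)
    (Y : (k : Fin D.K) → Matrix (Fin (D.dB k)) (Fin (D.dB k)) ℂ) : Matrix n n ℂ :=
  D.U * Matrix.blockDiagonal' (fun k => X k ⊗ₖ Y k) * D.Uᴴ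

/-- The matrix algebra `⨁ₖ M(Aₖ) ⊗ 1`. -/
def algebra (D : SectorDecomposition n) : Set (Matrix n n ℂ) :=
  Set.range fun X => D.directSum X fun _ => 1

/-- The set of all `⨁ₖ pₖ ρₖ ⊗ μₖ`, with `p` a probability distribution on the sectors and
`ρₖ` an arbitrary state on `Aₖ`, for a given family `μₖ`. -/
def code (D : SectorDecomposition n)
    (μ : (k : Fin D.K) → Matrix (Fin (D.dB k)) (Fin (D.dB k)) ℂ) : Set (Matrix n n ℂ) :=
  {σ | ∃ (p : Fin D.K → ℝ) (ρ : (k : Fin D.K) → Matrix (Fin (D.dA k)) (Fin (D.dA k)) ℂ),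
    (∀ k, 0 ≤ p k) ∧ ∑ k, p k = 1 ∧ (∀ k, IsState (ρ k)) ∧
      σ = D.directSum (fun k => p k • ρ k) μ}

end SectorDecomposition

end QInfo

end

/-! Write `E` in Kraus form with operators `K i`. The given fixed point yields a positive definite
fixed point ρ, because the positive and negative parts of the Hermitian and anti-Hermitian parts of
a fixed point are again fixed (`exists_posDef_fixed`). Pairing the defect `E†(X†X) - X†X = ∑
[Kᵢ,X]†[Kᵢ,X]` with ρ shows that the fixed points of `E†` are exactly the `*`-commutant of the Kraus
operators. This is a `*`-algebra closed under functional calculus, and minimal projections split it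
into blocks `M(Aₖ) ⊗ 1` (`exists_sectorDecomposition`).

By duality, fixedness of these blocks says that the block-diagonal partial trace `reduce` does not
see `E`. Hence each reset channel, `reduce` followed by insertion of states μₖ on the `Bₖ`, absorbs
`E`. Twirling ρ over the matrix units produces fixed points `⨁ Xₖ ⊗ τₖ`, and a dimension count shows
that there are no others (`exists_channel_fixed`).

Any code `⨁ pₖ ρₖ ⊗ μₖ` is the set of fixed states of a reset channel, so it is noiseless.
Conversely, averaging over powers of `E` shows that a difference from a noiseless code has no more
trace norm than its ergodic mean. That mean is recovered by the τ-reset after any μ-reset, so reset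
channels preserve every noiseless code (`IsNoiseless.isPreserved`). An isometric copy of the fixed
states inside a noiseless code therefore gives an injective endomorphism of a finite-dimensional
space, and surjectivity leaves no room for extra states: the codes are maximum.

If `C` is maximum, the τ-reset maps it bijectively onto its fixed states, so `reduce` is a bijection
from `C` onto the states of the algebra. Extending to the cone over `C`, let `W` be the element
reducing to `1`. Elements reducing to complementary projections are corners of `W`, so `W` commutes
with the algebra and equals `⨁ 1 ⊗ μₖ`. Spectral decomposition then determines all of `C`
(`exists_eq_code`). Changing the μₖ is an isometry, and maximally mixed μₖ give the states of the
algebra. -/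

set_option linter.unusedSectionVars false

noncomputable section

namespace QInfo

/-! ### Trace norm and positive trace-preserving maps -/

section TraceNorm

variable {n : Type*} [Fintype n] [DecidableEq n]

/-- Linear maps on matrices that are positive and trace preserving. -/
structure IsPositiveTP (F : Matrix n n ℂ →ₗ[ℂ] Matrix n n ℂ) : Prop where
  pos : ∀ X : Matrix n n ℂ, X.PosSemidef → (F X).PosSemidef
  trace : ∀ X : Matrix n n ℂ, (F X).trace = X.trace

/-- An orthogonal projection matrix. -/
structure IsProj (π : Matrix n n ℂ) : Prop where
  herm : π.IsHermitian
  idem : π * π = π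

theorem IsProj.compl {π : Matrix n n ℂ} (h : IsProj π) : IsProj (1 - π) where
  herm := Matrix.isHermitian_one.sub h.herm
  idem := by simp [mul_sub, sub_mul, h.idem]

theorem IsProj.posSemidef {π : Matrix n n ℂ} (h : IsProj π) : π.PosSemidef := by
  have := Matrix.posSemidef_conjTranspose_mul_self π
  rwa [h.herm.eq, h.idem] at this

/-- Functions on the spectrum of a matrix are continuous, so they give projections. -/
theorem isProj_cfc (x : Matrix n n ℂ) (s : Set ℝ) [DecidablePred (· ∈ s)] :
    IsProj (cfc (fun t : ℝ => if t ∈ s then (1 : ℝ) else 0) x) where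
  herm := cfc_predicate (R := ℝ) (p := IsSelfAdjoint) _ x
  idem := by
    rw [← cfc_mul _ _ x (x.finite_real_spectrum.continuousOn _)
      (x.finite_real_spectrum.continuousOn _)]
    congr 1
    ext t
    simp

theorem exists_posPart_proj {x : Matrix n n ℂ} (hx : x.IsHermitian) :
    ∃ π : Matrix n n ℂ, IsProj π ∧ Commute π x ∧ (π * x).PosSemidef ∧
      (-((1 - π) * x)).PosSemidef := by
  have hx' : IsSelfAdjoint x := hx
  have hc (f : ℝ → ℝ) : ContinuousOn f (spectrum ℝ x) := x.finite_real_spectrum.continuousOn f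
  let f : ℝ → ℝ := fun t => if t ∈ Set.Ioi (0 : ℝ) then 1 else 0
  have h1 : cfc f x * x = cfc (fun t => f t * t) x := by
    rw [cfc_mul f (fun t => t) x (hc _) (hc _), cfc_id' ℝ x]
  refine ⟨cfc f x, isProj_cfc x _, (Commute.refl x).cfc_real f, ?_, ?_⟩
  · rw [h1, ← Matrix.nonneg_iff_posSemidef]
    refine cfc_nonneg fun t _ => ?_
    simp only [f, Set.mem_Ioi]
    split_ifs with h
    · simpa using h.le
    · simp
  · have h2 : -((1 - cfc f x) * x) = cfc (fun t => f t * t - t) x := by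
      rw [cfc_sub _ _ x (hc _) (hc _), cfc_id' ℝ x, ← h1]
      simp [sub_mul]
    rw [h2, ← Matrix.nonneg_iff_posSemidef]
    refine cfc_nonneg fun t _ => ?_
    simp only [f, Set.mem_Ioi]
    split_ifs with h
    · simp
    · simpa using h

theorem _root_.Matrix.PosSemidef.trace_re_nonneg {Q : Matrix n n ℂ} (hQ : Q.PosSemidef) :
    0 ≤ Q.trace.re := (Complex.le_def.1 hQ.trace_nonneg).1

theorem _root_.Matrix.PosSemidef.trace_eq_re {Q : Matrix n n ℂ} (hQ : Q.PosSemidef) :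
    Q.trace = (Q.trace.re : ℂ) :=
  Complex.ext rfl (by simpa using (Complex.le_def.1 hQ.trace_nonneg).2.symm)

theorem _root_.Matrix.PosSemidef.eq_zero_of_trace_re {Q : Matrix n n ℂ} (hQ : Q.PosSemidef)
    (h : Q.trace.re = 0) : Q = 0 :=
  hQ.trace_eq_zero_iff.1 (by rw [hQ.trace_eq_re, h, Complex.ofReal_zero])

theorem IsProj.trace_mul {π Q : Matrix n n ℂ} (h : IsProj π) :
    (π * Q).trace = (πᴴ * Q * π).trace := by
  rw [h.herm.eq, Matrix.trace_mul_cycle, h.idem]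

theorem IsProj.trace_mul_nonneg {π Q : Matrix n n ℂ} (h : IsProj π) (hQ : Q.PosSemidef) :
    0 ≤ (π * Q).trace.re := by
  rw [h.trace_mul]
  exact (hQ.conjTranspose_mul_mul_same π).trace_re_nonneg

theorem IsProj.trace_mul_le {π Q : Matrix n n ℂ} (h : IsProj π) (hQ : Q.PosSemidef) :
    (π * Q).trace.re ≤ Q.trace.re := by
  have := h.compl.trace_mul_nonneg hQ
  simp only [sub_mul, one_mul, Matrix.trace_sub, Complex.sub_re] at this
  linarith

/-- With `Q = B†B`, the trace is the squared Hilbert–Schmidt norm of `Bπ`. -/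
theorem IsProj.mul_eq_zero {π Q : Matrix n n ℂ} (h : IsProj π) (hQ : Q.PosSemidef)
    (h0 : (π * Q).trace.re ≤ 0) : π * Q = 0 := by
  obtain ⟨B, rfl⟩ := CStarAlgebra.nonneg_iff_eq_star_mul_self.mp hQ.nonneg
  have h1 : ((B * π)ᴴ * (B * π)).trace = 0 := by
    have e : (B * π)ᴴ * (B * π) = πᴴ * (star B * B) * π := by
      simp [Matrix.star_eq_conjTranspose, Matrix.conjTranspose_mul, Matrix.mul_assoc]
    have hp := hQ.conjTranspose_mul_mul_same π
    rw [e, hp.trace_eq_re, ← h.trace_mul, le_antisymm h0 (h.trace_mul_nonneg hQ),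
      Complex.ofReal_zero]
  have h2 : B * π = 0 := Matrix.trace_conjTranspose_mul_self_eq_zero_iff.1 h1
  have h3 : π * star B = 0 := by
    have := congrArg Matrix.conjTranspose h2
    rwa [Matrix.conjTranspose_mul, h.herm.eq, Matrix.conjTranspose_zero] at this
  rw [← mul_assoc, h3, zero_mul]

/-- Orthogonality gives `(P - Q)² = (P + Q)²`, so `P + Q` is the absolute value of `P - Q`. -/
theorem traceNorm_sub_of_mul_eq_zero {P Q : Matrix n n ℂ} (hP : P.PosSemidef) (hQ : Q.PosSemidef)
    (h : P * Q = 0) : traceNorm (P - Q) = P.trace.re + Q.trace.re := by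
  have h' : Q * P = 0 := by
    have := congrArg Matrix.conjTranspose h
    rwa [Matrix.conjTranspose_mul, hP.1.eq, hQ.1.eq, Matrix.conjTranspose_zero] at this
  have e : (P - Q)ᴴ * (P - Q) = (P + Q) * (P + Q) := by
    rw [Matrix.conjTranspose_sub, hP.1.eq, hQ.1.eq]
    simp [mul_sub, sub_mul, mul_add, add_mul, h, h']
  rw [traceNorm, e, CFC.sqrt_mul_self _ (hP.add hQ).nonneg, Matrix.trace_add, Complex.add_re]

theorem _root_.Matrix.PosSemidef.traceNorm {P : Matrix n n ℂ} (hP : P.PosSemidef) :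
    traceNorm P = P.trace.re := by
  simpa using traceNorm_sub_of_mul_eq_zero hP Matrix.PosSemidef.zero (by simp)

/-- The trace norm of a Hermitian matrix in terms of the support projection of its positive
part. -/
theorem traceNorm_eq_of_proj {x π : Matrix n n ℂ} (h : IsProj π) (hc : Commute π x)
    (h1 : (π * x).PosSemidef) (h2 : (-((1 - π) * x)).PosSemidef) :
    traceNorm x = (π * x).trace.re + (-((1 - π) * x)).trace.re := by
  have e : x = π * x - -((1 - π) * x) := by simp [sub_mul]
  conv_lhs => rw [e]
  refine traceNorm_sub_of_mul_eq_zero h1 h2 ?_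
  rw [hc.eq, mul_assoc, mul_neg, ← mul_assoc π (1 - π), mul_sub, mul_one, h.idem]
  simp

theorem exists_jordan {x : Matrix n n ℂ} (hx : x.IsHermitian) :
    ∃ P Q : Matrix n n ℂ, P.PosSemidef ∧ Q.PosSemidef ∧ x = P - Q ∧
      traceNorm x = P.trace.re + Q.trace.re := by
  obtain ⟨π, h, hc, h1, h2⟩ := exists_posPart_proj hx
  exact ⟨_, _, h1, h2, by simp [sub_mul], traceNorm_eq_of_proj h hc h1 h2⟩

/-- The Jordan decomposition is the cheapest one: compressing `P` and `Q` by a projection only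
lowers traces. The triangle inequality and contractivity of channels both follow from this. -/
theorem traceNorm_sub_le {P Q : Matrix n n ℂ} (hP : P.PosSemidef) (hQ : Q.PosSemidef) :
    traceNorm (P - Q) ≤ P.trace.re + Q.trace.re := by
  obtain ⟨π, h, hc, h1, h2⟩ := exists_posPart_proj (hP.1.sub hQ.1)
  rw [traceNorm_eq_of_proj h hc h1 h2]
  have e1 : (π * (P - Q)).trace.re = (π * P).trace.re - (π * Q).trace.re := by
    simp [mul_sub]
  have e2 : (-((1 - π) * (P - Q))).trace.re =
      ((1 - π) * Q).trace.re - ((1 - π) * P).trace.re := by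
    simp [mul_sub]
  have := h.trace_mul_le hP
  have := h.trace_mul_nonneg hQ
  have := h.compl.trace_mul_le hQ
  have := h.compl.trace_mul_nonneg hP
  linarith

theorem traceNorm_nonneg {x : Matrix n n ℂ} (hx : x.IsHermitian) : 0 ≤ traceNorm x := by
  obtain ⟨P, Q, hP, hQ, -, e⟩ := exists_jordan hx
  rw [e]
  exact add_nonneg hP.trace_re_nonneg hQ.trace_re_nonneg

theorem traceNorm_add_le {x y : Matrix n n ℂ} (hx : x.IsHermitian) (hy : y.IsHermitian) :
    traceNorm (x + y) ≤ traceNorm x + traceNorm y := by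
  obtain ⟨P, Q, hP, hQ, rfl, e⟩ := exists_jordan hx
  obtain ⟨P', Q', hP', hQ', rfl, e'⟩ := exists_jordan hy
  have := traceNorm_sub_le (hP.add hP') (hQ.add hQ')
  rw [e, e', show P - Q + (P' - Q') = P + P' - (Q + Q') by abel]
  simp only [Matrix.trace_add, Complex.add_re] at this
  linarith

theorem eq_zero_of_traceNorm {x : Matrix n n ℂ} (hx : x.IsHermitian) (h : traceNorm x = 0) :
    x = 0 := by
  obtain ⟨P, Q, hP, hQ, rfl, e⟩ := exists_jordan hx
  have h1 := hP.trace_re_nonneg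
  have h2 := hQ.trace_re_nonneg
  rw [hP.eq_zero_of_trace_re (by linarith), hQ.eq_zero_of_trace_re (by linarith), sub_zero]

/-- The trace norm exceeds the trace by twice the trace of the negative part. -/
theorem posSemidef_of_traceNorm_le_trace {x : Matrix n n ℂ} (hx : x.IsHermitian)
    (h : traceNorm x ≤ x.trace.re) : x.PosSemidef := by
  obtain ⟨P, Q, hP, hQ, rfl, e⟩ := exists_jordan hx
  have h2 := hQ.trace_re_nonneg
  simp only [Matrix.trace_sub, Complex.sub_re] at h
  rwa [hQ.eq_zero_of_trace_re (by linarith), sub_zero]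

theorem traceNorm_smul {x : Matrix n n ℂ} (hx : x.IsHermitian) {c : ℝ} (hc : 0 ≤ c) :
    traceNorm (c • x) = c * traceNorm x := by
  obtain ⟨π, h, hcm, h1, h2⟩ := exists_posPart_proj hx
  have hc' : (0 : ℂ) ≤ (c : ℂ) := by exact_mod_cast hc
  have e : c • x = (c : ℂ) • x := by ext; simp
  rw [traceNorm_eq_of_proj h hcm h1 h2, e, traceNorm_eq_of_proj h (hcm.smul_right _)]
  · simp [mul_add]
  · rw [Matrix.mul_smul]
    exact h1.smul hc'
  · rw [Matrix.mul_smul, ← smul_neg]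
    exact h2.smul hc'

theorem traceNorm_neg (x : Matrix n n ℂ) : traceNorm (-x) = traceNorm x := by
  simp [traceNorm]

namespace IsPositiveTP

variable {F G : Matrix n n ℂ →ₗ[ℂ] Matrix n n ℂ}

theorem isHermitian (hF : IsPositiveTP F) {x : Matrix n n ℂ} (hx : x.IsHermitian) :
    (F x).IsHermitian := by
  obtain ⟨P, Q, hP, hQ, rfl, -⟩ := exists_jordan hx
  rw [map_sub]
  exact (hF.pos P hP).1.sub (hF.pos Q hQ).1

theorem isState (hF : IsPositiveTP F) {x : Matrix n n ℂ} (hx : IsState x) : IsState (F x) :=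
  ⟨hF.pos x hx.1, (hF.trace x).trans hx.2⟩

theorem traceNorm_le (hF : IsPositiveTP F) {x : Matrix n n ℂ} (hx : x.IsHermitian) :
    traceNorm (F x) ≤ traceNorm x := by
  obtain ⟨P, Q, hP, hQ, rfl, e⟩ := exists_jordan hx
  rw [e, map_sub, ← hF.trace P, ← hF.trace Q]
  exact traceNorm_sub_le (hF.pos P hP) (hF.pos Q hQ)

/-- The positive and negative parts of a Hermitian fixed point are fixed points. -/
theorem exists_jordan_fixed (hF : IsPositiveTP F) {x : Matrix n n ℂ} (hx : x.IsHermitian)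
    (hfix : F x = x) :
    ∃ P Q : Matrix n n ℂ, P.PosSemidef ∧ Q.PosSemidef ∧ x = P - Q ∧
      traceNorm x = P.trace.re + Q.trace.re ∧ F P = P ∧ F Q = Q ∧ P * Q = 0 := by
  obtain ⟨π, h, hc, h1, h2⟩ := exists_posPart_proj hx
  have e := traceNorm_eq_of_proj h hc h1 h2
  set P := π * x with hPd
  set Q := -((1 - π) * x) with hQd
  have hx2 : x = P - Q := by simp [hPd, hQd, sub_mul]
  have hfix2 : F P - F Q = x := by rw [← map_sub, ← hx2, hfix]
  have hP' := hF.pos P h1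
  have hQ' := hF.pos Q h2
  have tP : P.trace.re = (π * F P).trace.re - (π * F Q).trace.re := by
    have : P = π * F P - π * F Q := by rw [← mul_sub, hfix2]
    conv_lhs => rw [this]
    simp
  have tF : (F P).trace.re = P.trace.re := by rw [hF.trace]
  have l1 := h.trace_mul_le hP'
  have l2 := h.trace_mul_nonneg hQ'
  -- The chain `tr P = tr πF(P) - tr πF(Q) ≤ tr F(P) = tr P` is tight, so `F Q` lives off π and `F
  -- P` on it.
  have z1 : π * F Q = 0 := h.mul_eq_zero hQ' (by linarith)
  have z2 : (1 - π) * F P = 0 := h.compl.mul_eq_zero hP' (by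
    simp only [sub_mul, one_mul, Matrix.trace_sub, Complex.sub_re]
    linarith)
  have fP : F P = P := by
    have : P = π * F P - π * F Q := by rw [← mul_sub, hfix2]
    rw [sub_mul, one_mul, sub_eq_zero] at z2
    rw [z2, ← sub_zero (π * F P), ← z1, ← this]
  refine ⟨P, Q, h1, h2, hx2, e, fP, ?_, ?_⟩
  · have : Q = P - x := by rw [hx2]; abel
    rw [this, map_sub, fP, hfix]
  · rw [hPd, hQd, hc.eq, mul_assoc, mul_neg, ← mul_assoc π (1 - π), mul_sub, mul_one, h.idem]
    simp

theorem id : IsPositiveTP (LinearMap.id : Matrix n n ℂ →ₗ[ℂ] Matrix n n ℂ) :=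
  ⟨fun _ h => h, fun _ => rfl⟩

theorem comp (hF : IsPositiveTP F) (hG : IsPositiveTP G) : IsPositiveTP (F ∘ₗ G) :=
  ⟨fun _ h => hF.pos _ (hG.pos _ h), fun _ => (hF.trace _).trans (hG.trace _)⟩

theorem pow (hF : IsPositiveTP F) (k : ℕ) :
    IsPositiveTP ((F : Module.End ℂ (Matrix n n ℂ)) ^ k) := by
  induction k with
  | zero => exact id
  | succ k ih =>
    rw [pow_succ]
    exact ih.comp hF

end IsPositiveTP

theorem convex_isPositiveTP :
    Convex ℝ {F : Module.End ℂ (Matrix n n ℂ) | IsPositiveTP F} := by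
  intro F hF G hG a b ha hb hab
  have e (X : Matrix n n ℂ) : (a • F + b • G) X = (a : ℂ) • F X + (b : ℂ) • G X := by
    ext; simp
  refine ⟨fun X hX => ?_, fun X => ?_⟩
  · rw [e]
    exact ((hF.pos X hX).smul (by exact_mod_cast ha)).add
      ((hG.pos X hX).smul (by exact_mod_cast hb))
  · rw [e, Matrix.trace_add, Matrix.trace_smul, Matrix.trace_smul, hF.trace, hG.trace,
      ← add_smul, ← Complex.ofReal_add, hab, Complex.ofReal_one, one_smul]

theorem IsPositiveTP.of_mem_convexHull {E F : Module.End ℂ (Matrix n n ℂ)} (hE : IsPositiveTP E)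
    (hF : F ∈ convexHull ℝ (Set.range fun k : ℕ => E ^ k)) : IsPositiveTP F :=
  convexHull_min (by rintro _ ⟨k, rfl⟩; exact hE.pow k) convex_isPositiveTP hF

theorem convex_isState : Convex ℝ {ρ : Matrix n n ℂ | IsState ρ} := by
  intro ρ hρ σ hσ a b ha hb hab
  have e : a • ρ + b • σ = (a : ℂ) • ρ + (b : ℂ) • σ := by ext; simp
  rw [e]
  refine ⟨(hρ.1.smul (by exact_mod_cast ha)).add (hσ.1.smul (by exact_mod_cast hb)), ?_⟩
  rw [Matrix.trace_add, Matrix.trace_smul, Matrix.trace_smul, hρ.2, hσ.2,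
      ← add_smul, ← Complex.ofReal_add, hab, Complex.ofReal_one, one_smul]

end TraceNorm

/-! ### Fixed states of idempotent channels and maximality -/

section FixedStates

variable {n : Type*} [Fintype n] [DecidableEq n]

/-- The states that are fixed by a map. -/
def fixedStates (Φ : Matrix n n ℂ →ₗ[ℂ] Matrix n n ℂ) : Set (Matrix n n ℂ) :=
  {ρ | IsState ρ ∧ Φ ρ = ρ}

variable {Φ E : Matrix n n ℂ →ₗ[ℂ] Matrix n n ℂ} {C : Set (Matrix n n ℂ)}

theorem convex_fixedStates : Convex ℝ (fixedStates Φ) := by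
  intro ρ hρ σ hσ a b ha hb hab
  refine ⟨convex_isState hρ.1 hσ.1 ha hb hab, ?_⟩
  rw [map_add, LinearMap.map_smul_of_tower, LinearMap.map_smul_of_tower, hρ.2, hσ.2]

theorem convexHull_isState (hC : ∀ ρ ∈ C, IsState ρ) {ρ : Matrix n n ℂ}
    (hρ : ρ ∈ convexHull ℝ C) : IsState ρ :=
  convexHull_min (t := {ρ | IsState ρ}) hC convex_isState hρ

theorem isHermitian_weighted {ρ σ : Matrix n n ℂ} (hρ : ρ.IsHermitian) (hσ : σ.IsHermitian)
    (p q : ℝ) : (p • ρ - q • σ).IsHermitian := by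
  have e : p • ρ - q • σ = (p : ℂ) • ρ - (q : ℂ) • σ := by ext; simp
  rw [e]
  refine Matrix.IsHermitian.sub ?_ ?_ <;>
  · rw [Matrix.IsHermitian, Matrix.conjTranspose_smul, Complex.star_def, Complex.conj_ofReal]
    congr 1

theorem map_weighted (Φ : Matrix n n ℂ →ₗ[ℂ] Matrix n n ℂ) (ρ σ : Matrix n n ℂ) (p q : ℝ) :
    Φ (p • ρ - q • σ) = p • Φ ρ - q • Φ σ := by
  rw [map_sub, LinearMap.map_smul_of_tower, LinearMap.map_smul_of_tower]

/-- The weight `p = 1/2` turns preservation into preservation of the trace distance. -/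
theorem IsPreserved.injOn (hC : ∀ ρ ∈ C, IsState ρ)
    (h : IsPreserved Φ C) : Set.InjOn Φ (convexHull ℝ C) := by
  intro ρ hρ σ hσ e
  have h1 := h ρ hρ σ hσ (1 / 2) ⟨by norm_num, by norm_num⟩
  have h2 : traceNorm ((1 / 2 : ℝ) • ρ - (1 - 1 / 2 : ℝ) • σ) = 0 := by
    rw [← h1, map_weighted, e, ← sub_smul]
    norm_num
    simpa using (Matrix.PosSemidef.zero (n := n) (R := ℂ)).traceNorm
  have h3 := eq_zero_of_traceNorm (isHermitian_weighted (convexHull_isState hC hρ).1.1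
    (convexHull_isState hC hσ).1.1 _ _) h2
  rw [show (1 - 1 / 2 : ℝ) = 1 / 2 by norm_num, ← smul_sub] at h3
  rcases smul_eq_zero.1 h3 with h4 | h4
  · norm_num at h4
  · exact sub_eq_zero.1 h4

theorem exists_fixedStates_smul (hne : (fixedStates Φ).Nonempty) {P : Matrix n n ℂ}
    (hP : P.PosSemidef) (hfix : Φ P = P) : ∃ ρ ∈ fixedStates Φ, P = P.trace.re • ρ := by
  by_cases h : P.trace.re = 0
  · obtain ⟨ρ, hρ⟩ := hne
    exact ⟨ρ, hρ, by rw [h, zero_smul, hP.eq_zero_of_trace_re h]⟩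
  · have e : (P.trace.re)⁻¹ • P = ((P.trace.re⁻¹ : ℝ) : ℂ) • P := by ext; simp
    refine ⟨(P.trace.re)⁻¹ • P, ⟨⟨?_, ?_⟩, ?_⟩, ?_⟩
    · rw [e]
      exact hP.smul (by exact_mod_cast inv_nonneg.2 hP.trace_re_nonneg)
    · rw [e, Matrix.trace_smul, hP.trace_eq_re, smul_eq_mul, ← Complex.ofReal_mul,
        Complex.ofReal_re, inv_mul_cancel₀ h, Complex.ofReal_one]
    · rw [LinearMap.map_smul_of_tower, hfix]
    · rw [smul_smul, mul_inv_cancel₀ h, one_smul]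

/-- Normalizing the Jordan parts, which are fixed, extends what is known of weighted differences of
code states to the whole real space of Hermitian fixed points. -/
theorem exists_weighted (hΦ : IsPositiveTP Φ) {x : Matrix n n ℂ} (hx : x.IsHermitian)
    (hfix : Φ x = x) (hne : (fixedStates Φ).Nonempty) :
    ∃ ρ ∈ fixedStates Φ, ∃ σ ∈ fixedStates Φ, ∃ p ∈ Set.Icc (0 : ℝ) 1, ∃ c : ℝ, 0 ≤ c ∧
      x = c • (p • ρ - (1 - p) • σ) := by
  obtain ⟨P, Q, hP, hQ, rfl, -, fP, fQ, -⟩ := hΦ.exists_jordan_fixed hx hfix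
  obtain ⟨ρ, hρ, eP⟩ := exists_fixedStates_smul hne hP fP
  obtain ⟨σ, hσ, eQ⟩ := exists_fixedStates_smul hne hQ fQ
  have h1 := hP.trace_re_nonneg
  have h2 := hQ.trace_re_nonneg
  generalize P.trace.re = a at eP h1
  generalize Q.trace.re = b at eQ h2
  subst eP eQ
  rcases (add_nonneg h1 h2).eq_or_lt with h | h
  · obtain rfl : a = 0 := by linarith
    obtain rfl : b = 0 := by linarith
    exact ⟨ρ, hρ, σ, hσ, 0, ⟨le_rfl, zero_le_one⟩, 0, le_rfl, by simp⟩
  · refine ⟨ρ, hρ, σ, hσ, a / (a + b), ⟨by positivity, (div_le_one h).2 (by linarith)⟩,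
      a + b, h.le, ?_⟩
    rw [smul_sub, smul_smul, smul_smul]
    congr 2 <;> field_simp
    ring

/-- The Hermitian fixed points of a map, as a real subspace. -/
def hermitianFixed (Φ : Matrix n n ℂ →ₗ[ℂ] Matrix n n ℂ) : Submodule ℝ (Matrix n n ℂ) where
  carrier := {x | x.IsHermitian ∧ Φ x = x}
  add_mem' h h' := ⟨h.1.add h'.1, by rw [map_add, h.2, h'.2]⟩
  zero_mem' := ⟨Matrix.isHermitian_zero, map_zero _⟩
  smul_mem' c x h :=
    ⟨by simpa using isHermitian_weighted h.1 h.1 c 0, by rw [LinearMap.map_smul_of_tower, h.2]⟩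

theorem IsState.trace_re {ρ : Matrix n n ℂ} (h : IsState ρ) : ρ.trace.re = 1 := by
  rw [h.2, Complex.one_re]

/-- If an idempotent channel preserves all noiseless codes and its fixed states form a noiseless
code, then that code is maximum. -/
theorem isMaximumNoiseless_fixedStates (hΦ : IsPositiveTP Φ) (hidem : ∀ X, Φ (Φ X) = Φ X)
    (hpres : ∀ C, IsNoiseless E C → IsPreserved Φ C)
    (hnoiseless : IsNoiseless E (fixedStates Φ)) : IsMaximumNoiseless E (fixedStates Φ) := by
  refine ⟨hnoiseless, ?_⟩
  rintro ⟨Cbig, Csmall, hbig, hss, f, hf, hiso⟩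
  obtain ⟨c, hc, hcs⟩ := Set.exists_of_ssubset hss
  have hmap {x} (hx : x ∈ Cbig) : Φ x ∈ fixedStates Φ := ⟨hΦ.isState (hbig.1 x hx), hidem x⟩
  have hne : (fixedStates Φ).Nonempty := ⟨_, hmap hc⟩
  rw [convex_fixedStates.convexHull_eq] at hiso
  have hfbig {ρ} (hρ : ρ ∈ fixedStates Φ) : f ρ ∈ Cbig := hss.1 (hf.mapsTo hρ)
  have key : ∀ x ∈ hermitianFixed Φ, Φ (f x) ∈ hermitianFixed Φ ∧
      traceNorm (Φ (f x)) = traceNorm x ∧ (Φ (f x)).trace.re = x.trace.re := by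
    rintro x ⟨hx, hx'⟩
    obtain ⟨ρ, hρ, σ, hσ, p, hp, c, hc0, rfl⟩ := exists_weighted hΦ hx hx' hne
    have sρ := hbig.1 _ (hfbig hρ)
    have sσ := hbig.1 _ (hfbig hσ)
    have h1 := hpres _ hbig (f ρ) (subset_convexHull ℝ _ (hfbig hρ)) (f σ)
      (subset_convexHull ℝ _ (hfbig hσ)) p hp
    have e : Φ (f (c • (p • ρ - (1 - p) • σ))) = c • Φ (p • f ρ - (1 - p) • f σ) := by
      rw [LinearMap.map_smul_of_tower, LinearMap.map_smul_of_tower, map_weighted]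
    have hH := isHermitian_weighted sρ.1.1 sσ.1.1 p (1 - p)
    have hH' := isHermitian_weighted hρ.1.1.1 hσ.1.1.1 p (1 - p)
    rw [e]
    refine ⟨(hermitianFixed Φ).smul_mem c ⟨hΦ.isHermitian hH, hidem _⟩, ?_, ?_⟩
    · rw [traceNorm_smul (hΦ.isHermitian hH) hc0, h1, hiso ρ hρ σ hσ p hp,
        traceNorm_smul hH' hc0]
    · simp [hΦ.trace, sρ.trace_re, sσ.trace_re, hρ.1.trace_re, hσ.1.trace_re]
  -- `Φ ∘ f` is a trace-norm isometry of a finite-dimensional space into itself, hence onto; it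
  -- therefore reaches `Φ c` for the extra code state `c`.
  let g : hermitianFixed Φ →ₗ[ℝ] hermitianFixed Φ :=
    ((Φ ∘ₗ f).restrictScalars ℝ).restrict fun x hx => (key x hx).1
  have hg (x : hermitianFixed Φ) : (g x : Matrix n n ℂ) = Φ (f x) := rfl
  have hinj : Function.Injective g := by
    rw [← LinearMap.ker_eq_bot, LinearMap.ker_eq_bot']
    intro x hx
    have h1 := (key x x.2).2.1
    rw [← hg, hx] at h1
    refine Subtype.ext (eq_zero_of_traceNorm x.2.1 (h1.symm.trans ?_))
    simpa using (Matrix.PosSemidef.zero (n := n) (R := ℂ)).traceNorm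
  have hsurj := LinearMap.injective_iff_surjective.1 hinj
  obtain ⟨y, hy⟩ := hsurj ⟨Φ c, (hmap hc).1.1.1, hidem c⟩
  have hy' : Φ (f y) = Φ c := by rw [← hg, hy]
  obtain ⟨-, k1, k2⟩ := key y y.2
  have hs := (hmap hc).1
  rw [hy', hs.1.traceNorm, hs.trace_re] at k1
  rw [hy', hs.trace_re] at k2
  -- The preimage `y` has trace and trace norm `1`, so it is a state, and `f y` and `c` are two
  -- elements of `Cbig` with the same image under Φ.
  have hpos := posSemidef_of_traceNorm_le_trace y.2.1 (by rw [← k1, ← k2])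
  have hyst : (y : Matrix n n ℂ) ∈ fixedStates Φ :=
    ⟨⟨hpos, by rw [hpos.trace_eq_re, ← k2, Complex.ofReal_one]⟩, y.2.2⟩
  have := (hpres _ hbig).injOn hbig.1 (subset_convexHull ℝ _ (hfbig hyst))
    (subset_convexHull ℝ _ hc) hy'
  exact hcs (this ▸ hf.mapsTo hyst)

/-- An idempotent channel that preserves a maximum noiseless code maps it bijectively onto its
fixed states. -/
theorem IsMaximumNoiseless.image_eq (hΦ : IsPositiveTP Φ) (hidem : ∀ X, Φ (Φ X) = Φ X)
    (hpres : ∀ C, IsNoiseless E C → IsPreserved Φ C)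
    (hnoiseless : IsNoiseless E (fixedStates Φ)) (hC : IsMaximumNoiseless E C) :
    Convex ℝ C ∧ Set.InjOn Φ C ∧ Φ '' C = fixedStates Φ := by
  have hp := hpres C hC.1
  have hinj := hp.injOn hC.1.1
  have hsub : Φ '' convexHull ℝ C ⊆ fixedStates Φ := by
    rintro _ ⟨x, hx, rfl⟩
    exact ⟨hΦ.isState (convexHull_isState hC.1.1 hx), hidem x⟩
  have himg : Φ '' C = fixedStates Φ := by
    by_contra hne
    -- A proper image would embed `C` isometrically as a strict subset of a noiseless code.
    refine hC.2 ⟨fixedStates Φ, Φ '' C, hnoiseless,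
      ((Set.image_mono (subset_convexHull ℝ C)).trans hsub).ssubset_of_ne hne, Φ,
      (hinj.mono (subset_convexHull ℝ C)).bijOn_image, fun ρ hρ σ hσ p hp' => ?_⟩
    rw [← map_weighted]
    exact hp ρ hρ σ hσ p hp'
  refine ⟨?_, hinj.mono (subset_convexHull ℝ C), himg⟩
  have : C = convexHull ℝ C := by
    refine (subset_convexHull ℝ C).antisymm fun x hx => ?_
    obtain ⟨y, hy, e⟩ := himg.symm ▸ hsub ⟨x, hx, rfl⟩
    rwa [← hinj (subset_convexHull ℝ C hy) hx e]
  rw [this]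
  exact convex_convexHull ℝ C

end FixedStates

/-! ### Kraus operators and the fixed points of the adjoint -/

section Kraus

variable {n : Type*} [Fintype n] [DecidableEq n]

/-- The map with Kraus operators `K`. -/
def krausMap {ι : Type*} [Fintype ι] (K : ι → Matrix n n ℂ) : Matrix n n ℂ →ₗ[ℂ] Matrix n n ℂ :=
  ∑ i, LinearMap.mulLeft ℂ (K i) ∘ₗ LinearMap.mulRight ℂ (K i)ᴴ

theorem krausMap_apply {ι : Type*} [Fintype ι] (K : ι → Matrix n n ℂ) (X : Matrix n n ℂ) :
    krausMap K X = ∑ i, K i * X * (K i)ᴴ := by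
  simp [krausMap, LinearMap.sum_apply, mul_assoc]

theorem exists_eq_star_mul_self {B : Type*} [CStarAlgebra B] [PartialOrder B] [StarOrderedRing B]
    {a : B} (h : 0 ≤ a) : ∃ b, a = star b * b := CStarAlgebra.nonneg_iff_eq_star_mul_self.mp h

/-- **Choi's theorem**: a completely positive map has Kraus operators. -/
theorem exists_krausMap (E : Matrix n n ℂ →CP Matrix n n ℂ) :
    ∃ K : n × n → Matrix n n ℂ, E.toLinearMap = krausMap K := by
  rcases isEmpty_or_nonempty n with hn | ⟨⟨i0⟩⟩
  · exact ⟨fun _ => 0, by ext x i; exact hn.elim i⟩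
  -- The block matrix `M` of all matrix units is `N†N` with `N` having the single nonzero row `i0`.
  -- Positivity of its image, the Choi matrix, gives the factor `S` whose rows are the Kraus
  -- operators.
  let N : CStarMatrix n n (Matrix n n ℂ) :=
    CStarMatrix.ofMatrix (Matrix.of fun a j => if a = i0 then Matrix.single i0 j 1 else 0)
  let M : CStarMatrix n n (Matrix n n ℂ) :=
    CStarMatrix.ofMatrix (Matrix.of fun i j => Matrix.single i j 1)
  have hN' (a j) : N a j = if a = i0 then Matrix.single i0 j 1 else 0 := rfl
  have hM' (i j) : M i j = Matrix.single i j 1 := rfl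
  have hM : M = star N * N := by
    ext i j : 2
    rw [CStarMatrix.mul_apply]
    simp only [CStarMatrix.star_apply]
    rw [Finset.sum_eq_single i0]
    · rw [hN', hN', hM', if_pos rfl, if_pos rfl, Matrix.star_eq_conjTranspose]
      simp
    · intro b _ hb
      rw [hN', hN', if_neg hb, if_neg hb, mul_zero]
    · simp
  have hM0 : 0 ≤ M := hM ▸ star_mul_self_nonneg N
  have h := E.map_cstarMatrix_nonneg M hM0
  obtain ⟨S, hS⟩ := exists_eq_star_mul_self h
  have hE (i j : n) : E (Matrix.single i j 1) = ∑ l, (S l i)ᴴ * S l j := by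
    have := congrFun (congrFun hS i) j
    rw [CStarMatrix.mul_apply] at this
    simpa only [CStarMatrix.star_apply, CStarMatrix.map_apply, hM',
      Matrix.star_eq_conjTranspose] using this
  refine ⟨fun lm => Matrix.of fun a i => star (S lm.1 i lm.2 a), ?_⟩
  apply Matrix.ext_linearMap
  intro i j
  ext a b
  have hK (K : Matrix n n ℂ) :
      (K * Matrix.single i j (1 : ℂ) * Kᴴ : Matrix n n ℂ) a b = K a i * star (K b j) := by
    rw [Matrix.mul_assoc, Matrix.mul_apply, Finset.sum_eq_single i]
    · rw [Matrix.single_mul_apply_same, one_mul, Matrix.conjTranspose_apply]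
    · intro c _ hc
      rw [Matrix.single_mul_apply_of_ne _ _ _ _ _ hc, mul_zero]
    · simp
  have := congrFun (congrFun (hE i j) a) b
  change E (Matrix.single i j 1) a b = krausMap _ (Matrix.single i j 1) a b
  rw [krausMap_apply, Matrix.sum_apply]
  simp only [hK]
  refine this.trans ?_
  rw [Matrix.sum_apply, Fintype.sum_prod_type]
  simp [Matrix.mul_apply]

variable {ι : Type*} [Fintype ι] {K : ι → Matrix n n ℂ} {X Y ρ : Matrix n n ℂ}

theorem krausMap_conjTranspose (K : ι → Matrix n n ℂ) (X : Matrix n n ℂ) :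
    krausMap K Xᴴ = (krausMap K X)ᴴ := by
  simp [krausMap_apply, Matrix.conjTranspose_sum, Matrix.conjTranspose_mul, Matrix.mul_assoc]

theorem adjointMap_krausMap (K : ι → Matrix n n ℂ) :
    adjointMap (krausMap K) = krausMap fun i => (K i)ᴴ := by
  ext1 X
  refine Matrix.ext_iff_trace_mul_right.2 fun Y => ?_
  rw [trace_adjointMap_mul]
  simp only [krausMap_apply, Matrix.mul_sum, Matrix.sum_mul, Matrix.trace_sum,
    Matrix.conjTranspose_conjTranspose]
  refine Finset.sum_congr rfl fun i _ => ?_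
  rw [← Matrix.mul_assoc, Matrix.trace_mul_comm]
  simp only [Matrix.mul_assoc]

theorem sum_conjTranspose_mul_of_isTracePreserving (h : IsTracePreserving (krausMap K)) :
    ∑ i, (K i)ᴴ * K i = 1 := by
  have e : adjointMap (krausMap K) 1 = 1 := by
    refine Matrix.ext_iff_trace_mul_right.2 fun Y => ?_
    rw [trace_adjointMap_mul, one_mul, one_mul, h]
  simpa [adjointMap_krausMap, krausMap_apply] using e

theorem isPositiveTP_krausMap (h : IsTracePreserving (krausMap K)) :
    IsPositiveTP (krausMap K) where
  pos X hX := by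
    rw [krausMap_apply]
    exact Matrix.posSemidef_sum _ fun i _ => hX.mul_mul_conjTranspose_same (K i)
  trace := h

/-- A channel with a full-rank fixed point has a positive definite fixed point. -/
theorem exists_posDef_fixed (h : IsTracePreserving (krausMap K))
    (hr : X.rank = Fintype.card n) (hX : krausMap K X = X) :
    ∃ ρ : Matrix n n ℂ, ρ.PosDef ∧ krausMap K ρ = ρ := by
  have hF := isPositiveTP_krausMap h
  have hX' : krausMap K Xᴴ = Xᴴ := by rw [krausMap_conjTranspose, hX]
  obtain ⟨P, Q, hP, hQ, e, -, fP, fQ, -⟩ := hF.exists_jordan_fixed (x := X + Xᴴ)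
    (by simp [Matrix.IsHermitian, add_comm]) (by rw [map_add, hX, hX'])
  obtain ⟨P', Q', hP', hQ', e', -, fP', fQ', -⟩ := hF.exists_jordan_fixed
    (x := Complex.I • (X - Xᴴ))
    (by simp [Matrix.IsHermitian, ← smul_neg])
    (by rw [map_smul, map_sub, hX, hX'])
  -- A vector killed by the sum is killed by each positive summand, hence by `X + X†` and `X - X†`,
  -- hence by `X`, which is injective by full rank.
  refine ⟨P + Q + (P' + Q'), ?_, by simp only [map_add, fP, fQ, fP', fQ']⟩
  refine Matrix.PosDef.of_dotProduct_mulVec_pos ((hP.add hQ).add (hP'.add hQ')).1 fun v hv => ?_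
  have n1 := hP.dotProduct_mulVec_nonneg v
  have n2 := hQ.dotProduct_mulVec_nonneg v
  have n3 := hP'.dotProduct_mulVec_nonneg v
  have n4 := hQ'.dotProduct_mulVec_nonneg v
  simp only [Matrix.add_mulVec, dotProduct_add]
  refine lt_of_le_of_ne (by positivity) fun h0 => hv ?_
  obtain ⟨h1, h2⟩ := (add_eq_zero_iff_of_nonneg (add_nonneg n1 n2) (add_nonneg n3 n4)).1 h0.symm
  obtain ⟨z1, z2⟩ := (add_eq_zero_iff_of_nonneg n1 n2).1 h1
  obtain ⟨z3, z4⟩ := (add_eq_zero_iff_of_nonneg n3 n4).1 h2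
  rw [hP.dotProduct_mulVec_zero_iff] at z1
  rw [hQ.dotProduct_mulVec_zero_iff] at z2
  rw [hP'.dotProduct_mulVec_zero_iff] at z3
  rw [hQ'.dotProduct_mulVec_zero_iff] at z4
  have k1 : (X + Xᴴ) *ᵥ v = 0 := by rw [e, Matrix.sub_mulVec, z1, z2, sub_zero]
  have k2 : (Complex.I • (X - Xᴴ)) *ᵥ v = 0 := by rw [e', Matrix.sub_mulVec, z3, z4, sub_zero]
  rw [Matrix.smul_mulVec, smul_eq_zero_iff_right Complex.I_ne_zero, Matrix.sub_mulVec] at k2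
  rw [Matrix.add_mulVec] at k1
  have k3 : X *ᵥ v = 0 := by
    have : (2 : ℂ) • (X *ᵥ v) = 0 := by
      rw [two_smul]
      linear_combination (exp := 1) k1 + k2
    exact (smul_eq_zero_iff_right two_ne_zero).1 this
  have hsurj : Function.Surjective X.mulVecLin := by
    rw [← LinearMap.range_eq_top]
    exact Submodule.eq_top_of_finrank_eq (by rw [Module.finrank_fintype_fun_eq_card]; exact hr)
  exact LinearMap.injective_iff_surjective.2 hsurj
    (by simpa using k3)

theorem _root_.Matrix.PosDef.eq_zero_of_mul_mul_conjTranspose (hρ : ρ.PosDef)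
    (h : X * ρ * Xᴴ = 0) : X = 0 := by
  by_contra hne
  obtain ⟨v, hv⟩ : ∃ v, Xᴴ *ᵥ v ≠ 0 := by
    by_contra! hall
    refine hne ?_
    have : Xᴴ = 0 := Matrix.ext_of_mulVec_single fun j => by rw [hall, Matrix.zero_mulVec]
    simpa using congrArg Matrix.conjTranspose this
  have := hρ.dotProduct_mulVec_pos hv
  have e : star (Xᴴ *ᵥ v) ⬝ᵥ (ρ *ᵥ (Xᴴ *ᵥ v)) = star v ⬝ᵥ ((X * ρ * Xᴴ) *ᵥ v) := by
    rw [Matrix.star_mulVec, ← Matrix.dotProduct_mulVec]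
    simp [Matrix.mulVec_mulVec, Matrix.mul_assoc]
  rw [e, h] at this
  simp at this

/-- In the presence of a faithful fixed state, the fixed points of the adjoint channel commute
with the Kraus operators. -/
theorem commute_of_adjoint_fixed (h : IsTracePreserving (krausMap K)) (hρ : ρ.PosDef)
    (hfix : krausMap K ρ = ρ) (hX : adjointMap (krausMap K) X = X) (i : ι) :
    K i * X = X * K i := by
  have hone := sum_conjTranspose_mul_of_isTracePreserving h
  have hadj := adjointMap_krausMap K
  have hX' : adjointMap (krausMap K) Xᴴ = Xᴴ := by
    rw [hadj, krausMap_conjTranspose, ← hadj, hX]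
  -- The commutators measure the defect in the Schwarz inequality for `E†`; invariance of ρ makes
  -- the defect's expectation vanish, and faithfulness makes every commutator vanish.
  let D : ι → Matrix n n ℂ := fun i => K i * X - X * K i
  have hD : ∑ i, (D i)ᴴ * D i = adjointMap (krausMap K) (Xᴴ * X) - Xᴴ * X := by
    have e (i : ι) : (D i)ᴴ * D i = Xᴴ * ((K i)ᴴ * K i) * X - Xᴴ * ((K i)ᴴ * X * K i) -
        ((K i)ᴴ * Xᴴ * K i) * X + (K i)ᴴ * (Xᴴ * X) * K i := by
      simp only [D, Matrix.conjTranspose_sub, Matrix.conjTranspose_mul]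
      noncomm_ring
    have a1 : ∑ i, (K i)ᴴ * X * K i = X := by
      simpa [hadj, krausMap_apply] using hX
    have a2 : ∑ i, (K i)ᴴ * Xᴴ * K i = Xᴴ := by
      simpa [hadj, krausMap_apply] using hX'
    simp only [e, Finset.sum_add_distrib, Finset.sum_sub_distrib, ← Matrix.mul_sum,
      ← Matrix.sum_mul, hone, a1, a2, hadj, krausMap_apply, Matrix.conjTranspose_conjTranspose, mul_one]
    abel
  have htr : ∑ i, (D i * ρ * (D i)ᴴ).trace = 0 := by
    have := congrArg (fun Y => (Y * ρ).trace) hD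
    simp only [Matrix.sum_mul, Matrix.trace_sum, Matrix.sub_mul, Matrix.trace_sub,
      trace_adjointMap_mul, hfix, sub_self] at this
    rw [← this]
    refine Finset.sum_congr rfl fun i _ => ?_
    rw [Matrix.trace_mul_comm, ← Matrix.mul_assoc]
  have hpos (i : ι) : (D i * ρ * (D i)ᴴ).PosSemidef :=
    hρ.posSemidef.mul_mul_conjTranspose_same (D i)
  have h0 := (Finset.sum_eq_zero_iff_of_nonneg fun i _ => (hpos i).trace_nonneg).1 htr i
    (Finset.mem_univ i)
  rw [(hpos i).trace_eq_zero_iff] at h0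
  exact sub_eq_zero.1 (hρ.eq_zero_of_mul_mul_conjTranspose h0)

/-- In the presence of a faithful fixed state, the fixed points of the adjoint channel are the
commutant of the Kraus operators. -/
theorem mem_centralizer_iff_adjoint_fixed (h : IsTracePreserving (krausMap K)) (hρ : ρ.PosDef)
    (hfix : krausMap K ρ = ρ) :
    X ∈ StarSubalgebra.centralizer ℂ (Set.range K) ↔ adjointMap (krausMap K) X = X := by
  rw [StarSubalgebra.mem_centralizer_iff]
  constructor
  · intro hX
    rw [adjointMap_krausMap, krausMap_apply]
    conv_rhs => rw [← mul_one X, ← sum_conjTranspose_mul_of_isTracePreserving h, Finset.mul_sum]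
    refine Finset.sum_congr rfl fun i _ => ?_
    rw [← mul_assoc, ← Matrix.star_eq_conjTranspose, ← (hX (K i) ⟨i, rfl⟩).2,
      Matrix.star_eq_conjTranspose, Matrix.conjTranspose_conjTranspose]
  · rintro hX _ ⟨i, rfl⟩
    refine ⟨commute_of_adjoint_fixed h hρ hfix hX i, ?_⟩
    have hX' : adjointMap (krausMap K) Xᴴ = Xᴴ := by
      rw [adjointMap_krausMap, krausMap_conjTranspose, ← adjointMap_krausMap, hX]
    have := congrArg Matrix.conjTranspose (commute_of_adjoint_fixed h hρ hfix hX' i)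
    simpa [Matrix.star_eq_conjTranspose] using this.symm

end Kraus

/-! ### Structure of matrix `*`-algebras -/

/-- A property of finite families that bounds their length has a family that cannot be extended. -/
theorem exists_maximal_family {M : Type*} (Q : ∀ d : ℕ, (Fin d → M) → Prop)
    (h0 : Q 0 Fin.elim0) (N : ℕ) (hN : ∀ d v, Q d v → d ≤ N) :
    ∃ (d : ℕ) (v : Fin d → M), Q d v ∧ ∀ x, ¬ Q (d + 1) (Fin.snoc v x) := by
  classical
  let P : ℕ → Prop := fun d => ∃ v, Q d v
  have hP0 : P 0 := ⟨_, h0⟩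
  obtain ⟨v, hv⟩ : P (Nat.findGreatest P N) := Nat.findGreatest_spec (Nat.zero_le N) hP0
  refine ⟨_, v, hv, fun x hx => ?_⟩
  have := Nat.le_findGreatest (hN _ _ hx) (P := P) ⟨_, hx⟩
  omega

section Structure

variable {n : Type*} [Fintype n] [DecidableEq n] {A : StarSubalgebra ℂ (Matrix n n ℂ)}

theorem conjTranspose_mem {a : Matrix n n ℂ} (ha : a ∈ A) : aᴴ ∈ A := star_mem ha

theorem IsProj.mul_eq_comm {p e : Matrix n n ℂ} (hp : IsProj p) (he : IsProj e) (h : e * p = e) :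
    p * e = e := by
  have := congrArg Matrix.conjTranspose h
  rwa [Matrix.conjTranspose_mul, hp.herm.eq, he.herm.eq] at this

theorem IsProj.rank_lt {p e : Matrix n n ℂ} (hp : IsProj p) (he : IsProj e) (h : e * p = e)
    (hne : e ≠ p) : e.rank < p.rank := by
  refine Submodule.finrank_lt_finrank_of_lt (lt_of_le_of_ne ?_ fun heq => hne ?_)
  · rintro _ ⟨v, rfl⟩
    refine ⟨e *ᵥ v, ?_⟩
    simp [hp.mul_eq_comm he h]
  · have : e * p = p := by
      refine Matrix.ext_of_mulVec_single fun j => ?_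
      obtain ⟨u, hu⟩ := heq.symm ▸ LinearMap.mem_range_self p.mulVecLin (Pi.single j 1)
      simp only [Matrix.mulVecLin_apply] at hu
      rw [← Matrix.mulVec_mulVec, ← hu, Matrix.mulVec_mulVec, he.idem]
    rw [← h, this]

variable (A) in
/-- A minimal projection of a `*`-algebra of matrices. -/
structure IsMinProj (p : Matrix n n ℂ) : Prop where
  isProj : IsProj p
  mem : p ∈ A
  ne_zero : p ≠ 0
  eq_of_mul_eq : ∀ e ∈ A, IsProj e → e * p = e → e ≠ 0 → e = p

/-- Descent on the rank: a projection that is not minimal has a proper nonzero subprojection in the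
algebra. -/
theorem exists_isMinProj_le {q : Matrix n n ℂ} (hq : IsProj q) (hmem : q ∈ A) (hne : q ≠ 0) :
    ∃ p, IsMinProj A p ∧ p * q = p := by
  induction hr : q.rank using Nat.strong_induction_on generalizing q with
  | _ r ih =>
    by_cases hmin : ∀ e ∈ A, IsProj e → e * q = e → e ≠ 0 → e = q
    · exact ⟨q, ⟨hq, hmem, hne, hmin⟩, hq.idem⟩
    · push Not at hmin
      obtain ⟨e, heA, he, heq, he0, hne'⟩ := hmin
      obtain ⟨p, hp, hpe⟩ := ih _ (hr ▸ hq.rank_lt he heq hne') he heA he0 rfl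
      exact ⟨p, hp, by rw [← hpe, mul_assoc, heq]⟩

/-- A spectral projection of `pap` for a nonzero eigenvalue `t` lies below `p` and in the algebra,
so by minimality it is `p`, and `pap = t p`. -/
theorem IsMinProj.exists_compress_hermitian
    (hA : ∀ h ∈ A, ∀ f : ℝ → ℝ, cfc f h ∈ A) {p : Matrix n n ℂ} (hp : IsMinProj A p)
    {a : Matrix n n ℂ} (ha : a ∈ A) (hah : a.IsHermitian) : ∃ c : ℂ, p * a * p = c • p := by
  have hh : (p * a * p).IsHermitian := by
    rw [Matrix.IsHermitian, Matrix.conjTranspose_mul, Matrix.conjTranspose_mul,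
      hp.isProj.herm.eq, hah.eq, mul_assoc]
  have hm : p * a * p ∈ A := mul_mem (mul_mem hp.mem ha) hp.mem
  have hpp : p * a * p * p = p * a * p := by rw [mul_assoc, hp.isProj.idem]
  generalize p * a * p = h at hh hm hpp
  by_cases h0 : h = 0
  · exact ⟨0, by simp [h0]⟩
  obtain ⟨i, hi⟩ : ∃ i, hh.eigenvalues i ≠ 0 := by
    by_contra! hall
    exact h0 (hh.eigenvalues_eq_zero_iff.1 (funext hall))
  have hsp := hh.eigenvalues_mem_spectrum_real i
  generalize hh.eigenvalues i = t at hi hsp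
  have hsa : IsSelfAdjoint h := hh
  have hc (f : ℝ → ℝ) : ContinuousOn f (spectrum ℝ h) := h.finite_real_spectrum.continuousOn f
  let f : ℝ → ℝ := fun s => if s ∈ ({t} : Set ℝ) then 1 else 0
  have heh : cfc f h * h = t • cfc f h := by
    have h1 : cfc f h * h = cfc (fun s => f s * s) h := by
      rw [cfc_mul f (fun s => s) h (hc _) (hc _), cfc_id' ℝ h]
    rw [h1, ← cfc_smul t f h (hc _)]
    congr 1
    ext s
    by_cases hs : s = t <;> simp [f, hs]
  have hep : cfc f h * p = cfc f h := by
    have : cfc f h = t⁻¹ • (cfc f h * h) := by rw [heh, smul_smul, inv_mul_cancel₀ hi, one_smul]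
    rw [this, smul_mul_assoc, mul_assoc, hpp]
  have he0 : cfc f h ≠ 0 := by
    intro h0'
    have h1 : f t ∈ spectrum ℝ (cfc f h) := by
      rw [cfc_map_spectrum f h hsa (hc _)]
      exact ⟨t, hsp, rfl⟩
    have : Nonempty n := ⟨i⟩
    rw [h0', spectrum.zero_eq] at h1
    simp [f] at h1
  have hep' := hp.eq_of_mul_eq _ (hA h hm f) (isProj_cfc h _) hep he0
  refine ⟨(t : ℂ), ?_⟩
  rw [hep'] at heh
  have hph : p * h = h := by
    have := congrArg Matrix.conjTranspose hpp
    rwa [Matrix.conjTranspose_mul, hh.eq, hp.isProj.herm.eq] at this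
  rw [← hph, heh]
  ext
  simp

theorem IsMinProj.exists_compress (hA : ∀ h ∈ A, ∀ f : ℝ → ℝ, cfc f h ∈ A) {p : Matrix n n ℂ}
    (hp : IsMinProj A p) {a : Matrix n n ℂ} (ha : a ∈ A) : ∃ c : ℂ, p * a * p = c • p := by
  obtain ⟨c, hc⟩ := hp.exists_compress_hermitian hA (a := a + aᴴ)
    (add_mem ha (conjTranspose_mem ha)) (by simp [Matrix.IsHermitian, add_comm])
  obtain ⟨c', hc'⟩ := hp.exists_compress_hermitian hA (a := Complex.I • (a - aᴴ))
    (A.smul_mem (sub_mem ha (conjTranspose_mem ha)) _) (by simp [Matrix.IsHermitian, ← smul_neg])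
  refine ⟨(1 / 2 : ℂ) * (c - Complex.I * c'), ?_⟩
  have e : a = (1 / 2 : ℂ) • (a + aᴴ - Complex.I • (Complex.I • (a - aᴴ))) := by
    rw [smul_smul, Complex.I_mul_I, neg_smul, one_smul, sub_neg_eq_add, add_add_sub_cancel,
      ← two_smul ℂ a, smul_smul]
    norm_num
  rw [e, Matrix.mul_smul, Matrix.smul_mul, Matrix.mul_sub, Matrix.sub_mul, hc,
    Matrix.mul_smul, Matrix.smul_mul, hc', smul_smul, ← sub_smul, smul_smul]

theorem trace_re_pos_of_ne_zero {x : Matrix n n ℂ} (hx : x ≠ 0) : 0 < (xᴴ * x).trace.re := by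
  have hps := Matrix.posSemidef_conjTranspose_mul_self x
  refine lt_of_le_of_ne hps.trace_re_nonneg fun h => hx ?_
  rw [← Matrix.trace_conjTranspose_mul_self_eq_zero_iff, hps.trace_eq_re, ← h, Complex.ofReal_zero]

/-- The left ideal generated by a minimal projection `p` has a basis of partial isometries with
initial projection `p`. -/
theorem IsMinProj.exists_basis (hA : ∀ h ∈ A, ∀ f : ℝ → ℝ, cfc f h ∈ A) {p : Matrix n n ℂ}
    (hp : IsMinProj A p) :
    ∃ (d : ℕ) (v : Fin d → Matrix n n ℂ), (∀ a, v a ∈ A ∧ v a * p = v a) ∧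
      (∀ a b, (v a)ᴴ * v b = if a = b then p else 0) ∧
      ∀ x ∈ A, x * p = x → ∃ c : Fin d → ℂ, x = ∑ a, c a • v a := by
  obtain ⟨d, v, ⟨h1, h2⟩, hmax⟩ := exists_maximal_family
    (fun d (v : Fin d → Matrix n n ℂ) => (∀ a, v a ∈ A ∧ v a * p = v a) ∧
      ∀ a b, (v a)ᴴ * v b = if a = b then p else 0)
    ⟨fun a => a.elim0, fun a => a.elim0⟩ (Module.finrank ℂ (Matrix n n ℂ)) (by
      rintro d v ⟨-, h2⟩
      have hli : LinearIndependent ℂ v := by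
        rw [Fintype.linearIndependent_iff]
        intro g hg i
        have := congrArg (fun y => (v i)ᴴ * y) hg
        simp only [Matrix.mul_sum, Matrix.mul_smul, h2, smul_ite, smul_zero, Matrix.mul_zero,
          Finset.sum_ite_eq, Finset.mem_univ, if_true] at this
        exact (smul_eq_zero.1 this).resolve_right hp.ne_zero
      simpa using hli.fintype_card_le_finrank)
  refine ⟨d, v, h1, h2, fun x hx hxp => ?_⟩
  have hpadj {y : Matrix n n ℂ} (hy : y * p = y) : p * yᴴ = yᴴ := by
    have := congrArg Matrix.conjTranspose hy
    rwa [Matrix.conjTranspose_mul, hp.isProj.herm.eq] at this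
  have hsc {y z : Matrix n n ℂ} (hy : y ∈ A) (hz : z ∈ A) (hyp : y * p = y) (hzp : z * p = z) :
      ∃ c : ℂ, yᴴ * z = c • p := by
    obtain ⟨c, hc⟩ := hp.exists_compress hA (mul_mem (conjTranspose_mem hy) hz)
    refine ⟨c, ?_⟩
    rwa [← mul_assoc, hpadj hyp, mul_assoc, hzp] at hc
  choose c hc using fun a => hsc (h1 a).1 hx (h1 a).2 hxp
  refine ⟨c, ?_⟩
  by_contra hne
  -- If the residual `y` were nonzero, `y†y` would be a positive multiple of `p`, and the rescaled
  -- `y` would extend the maximal family.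
  set y := x - ∑ a, c a • v a with hyd
  have hy0 : y ≠ 0 := sub_ne_zero.2 hne
  have hyA : y ∈ A := sub_mem hx (sum_mem fun a _ => A.smul_mem (h1 a).1 _)
  have hyp : y * p = y := by
    simp only [hyd, Matrix.sub_mul, hxp, Matrix.sum_mul, Matrix.smul_mul, (h1 _).2]
  have hvy (a : Fin d) : (v a)ᴴ * y = 0 := by
    simp [hyd, Matrix.mul_sub, hc, Matrix.mul_sum, h2]
  have hyv (a : Fin d) : yᴴ * v a = 0 := by
    simpa using congrArg Matrix.conjTranspose (hvy a)
  obtain ⟨t, ht⟩ := hsc hyA hyA hyp hyp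
  have htr : t = (((yᴴ * y).trace.re / p.trace.re : ℝ) : ℂ) := by
    have hps := Matrix.posSemidef_conjTranspose_mul_self y
    have hpt : p.trace.re ≠ 0 := fun h => hp.ne_zero (hp.isProj.posSemidef.eq_zero_of_trace_re h)
    have := congrArg Matrix.trace ht
    rw [Matrix.trace_smul, hps.trace_eq_re, hp.isProj.posSemidef.trace_eq_re, smul_eq_mul] at this
    rw [Complex.ofReal_div, eq_div_iff (by exact_mod_cast hpt), this]
  have hppos : 0 < p.trace.re := by
    have := trace_re_pos_of_ne_zero hp.ne_zero
    rwa [hp.isProj.herm.eq, hp.isProj.idem] at this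
  have hr : 0 < (yᴴ * y).trace.re / p.trace.re := div_pos (trace_re_pos_of_ne_zero hy0) hppos
  generalize (yᴴ * y).trace.re / p.trace.re = r at htr hr
  let s : ℂ := ((√r)⁻¹ : ℝ)
  have hs : s * s * t = 1 := by
    rw [htr]
    simp only [s]
    rw [← Complex.ofReal_mul, ← Complex.ofReal_mul, ← mul_inv, Real.mul_self_sqrt hr.le,
      inv_mul_cancel₀ hr.ne', Complex.ofReal_one]
  have hss : star s = s := Complex.conj_ofReal _
  refine hmax (s • y) ⟨fun a => ?_, fun a b => ?_⟩
  · refine Fin.lastCases ?_ (fun a => ?_) a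
    · simpa [hyp] using A.smul_mem hyA s
    · simpa using h1 a
  · refine Fin.lastCases ?_ (fun a => ?_) a <;> refine Fin.lastCases ?_ (fun b => ?_) b
    · simp [ht, smul_smul, hss, ← mul_assoc, hs]
    · simp [hyv, (Fin.castSucc_lt_last b).ne']
    · simp [hvy, (Fin.castSucc_lt_last a).ne]
    · simp [h2]

/-- The range of a projection has an orthonormal basis. -/
theorem IsProj.exists_basis {p : Matrix n n ℂ} (hp : IsProj p) :
    ∃ (d : ℕ) (w : Fin d → n → ℂ), (∀ a, p *ᵥ w a = w a) ∧
      (∀ a b, star (w a) ⬝ᵥ w b = if a = b then 1 else 0) ∧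
      p = ∑ a, Matrix.vecMulVec (w a) (star (w a)) := by
  obtain ⟨d, w, ⟨h1, h2⟩, hmax⟩ := exists_maximal_family
    (fun d (w : Fin d → n → ℂ) => (∀ a, p *ᵥ w a = w a) ∧
      ∀ a b, star (w a) ⬝ᵥ w b = if a = b then 1 else 0)
    ⟨fun a => a.elim0, fun a => a.elim0⟩ (Fintype.card n) (by
      rintro d v ⟨-, h2⟩
      have hli : LinearIndependent ℂ v := by
        rw [Fintype.linearIndependent_iff]
        intro g hg i
        have := congrArg (fun y => star (v i) ⬝ᵥ y) hg
        simpa [dotProduct_sum, h2] using this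
      simpa using hli.fintype_card_le_finrank)
  refine ⟨d, w, h1, h2, ?_⟩
  by_contra hne
  obtain ⟨u, hu⟩ : ∃ u, (p - ∑ a, Matrix.vecMulVec (w a) (star (w a))) *ᵥ u ≠ 0 := by
    by_contra! hall
    exact hne (sub_eq_zero.1 (Matrix.ext_of_mulVec_single fun j => by
      rw [hall, Matrix.zero_mulVec]))
  set y := (p - ∑ a, Matrix.vecMulVec (w a) (star (w a))) *ᵥ u with hyd
  have hye : y = p *ᵥ u - ∑ a, (star (w a) ⬝ᵥ u) • w a := by
    rw [hyd, Matrix.sub_mulVec, Matrix.sum_mulVec]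
    congr 1
    refine Finset.sum_congr rfl fun a _ => ?_
    ext i
    simp [Matrix.vecMulVec_mulVec, mul_comm]
  have hpw (a : Fin d) : star (w a) ᵥ* p = star (w a) := by
    have := congrArg star (h1 a)
    rwa [Matrix.star_mulVec, hp.herm.eq] at this
  have hwy (a : Fin d) : star (w a) ⬝ᵥ y = 0 := by
    rw [hye, dotProduct_sub, Matrix.dotProduct_mulVec, hpw, dotProduct_sum]
    simp [h2]
  have hyw (a : Fin d) : star y ⬝ᵥ w a = 0 := by
    rw [Matrix.star_dotProduct, hwy, star_zero]
  have hpy : p *ᵥ y = y := by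
    rw [hye, Matrix.mulVec_sub, Matrix.mulVec_mulVec, hp.idem, Matrix.mulVec_sum]
    simp [Matrix.mulVec_smul, h1]
  have hpos : 0 < star y ⬝ᵥ y := by
    simpa using Matrix.dotProduct_star_self_pos_iff.2 hu
  obtain ⟨r, hr, hry⟩ : ∃ r : ℝ, 0 < r ∧ star y ⬝ᵥ y = r :=
    ⟨(star y ⬝ᵥ y).re, (Complex.lt_def.1 hpos).1,
      Complex.ext rfl (by simpa using (Complex.lt_def.1 hpos).2.symm)⟩
  let s : ℂ := ((√r)⁻¹ : ℝ)
  have hs : s * s * r = 1 := by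
    simp only [s]
    rw [← Complex.ofReal_mul, ← Complex.ofReal_mul, ← mul_inv, Real.mul_self_sqrt hr.le,
      inv_mul_cancel₀ hr.ne', Complex.ofReal_one]
  have hss : star s = s := Complex.conj_ofReal _
  refine hmax (s • y) ⟨fun a => ?_, fun a b => ?_⟩
  · refine Fin.lastCases ?_ (fun a => ?_) a
    · simp [Matrix.mulVec_smul, hpy]
    · simpa using h1 a
  · refine Fin.lastCases ?_ (fun a => ?_) a <;> refine Fin.lastCases ?_ (fun b => ?_) b
    · simp only [Fin.snoc_last, star_smul, hss, smul_dotProduct, dotProduct_smul, hry, if_true,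
        smul_eq_mul, ← mul_assoc, hs]
    · simp [hyw, (Fin.castSucc_lt_last b).ne']
    · simp [hwy, (Fin.castSucc_lt_last a).ne]
    · simp [h2]

/-- A `*`-algebra of matrices that is closed under the functional calculus is, up to a unitary, a
direct sum of full matrix algebras with multiplicities. -/
theorem exists_sectorDecomposition (hA : ∀ h ∈ A, ∀ f : ℝ → ℝ, cfc f h ∈ A) :
    ∃ D : SectorDecomposition n, D.algebra = (A : Set (Matrix n n ℂ)) := by
  -- One minimal projection is kept per sector: the family is maximal among those whose members are
  -- not linked through the algebra.
  obtain ⟨K, p, ⟨hp, hpp⟩, hmax⟩ := exists_maximal_family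
    (fun K (p : Fin K → Matrix n n ℂ) => (∀ k, IsMinProj A (p k)) ∧
      ∀ k l, k ≠ l → ∀ a ∈ A, p k * a * p l = 0)
    ⟨fun a => a.elim0, fun a => a.elim0⟩ (Module.finrank ℂ (Matrix n n ℂ)) (by
      rintro d p ⟨h1, h2⟩
      have hli : LinearIndependent ℂ p := by
        rw [Fintype.linearIndependent_iff]
        intro g hg i
        have := congrArg (fun y => p i * y) hg
        simp only [Matrix.mul_sum, Matrix.mul_smul, Matrix.mul_zero] at this
        rw [Finset.sum_eq_single i, (h1 i).isProj.idem] at this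
        · exact (smul_eq_zero.1 this).resolve_right (h1 i).ne_zero
        · intro j _ hj
          have := h2 i j hj.symm 1 (one_mem A)
          rw [mul_one] at this
          rw [this, smul_zero]
        · simp
      simpa using hli.fintype_card_le_finrank)
  have hinter (q : Matrix n n ℂ) (hq : IsMinProj A q) : ∃ k, ∃ a ∈ A, p k * a * q ≠ 0 := by
    by_contra! hall
    have hall' (k : Fin K) (a) (ha : a ∈ A) : q * a * p k = 0 := by
      have := congrArg Matrix.conjTranspose (hall k aᴴ (conjTranspose_mem ha))
      simpa [Matrix.conjTranspose_mul, (hp k).isProj.herm.eq, hq.isProj.herm.eq,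
        Matrix.mul_assoc] using this
    refine hmax q ⟨fun k => ?_, fun k l => ?_⟩
    · refine Fin.lastCases ?_ (fun k => ?_) k
      · simpa using hq
      · simpa using hp k
    · refine Fin.lastCases ?_ (fun k => ?_) k <;> refine Fin.lastCases ?_ (fun l => ?_) l
      · simp
      · simpa using fun _ => hall' l
      · simpa using hall k
      · simpa using hpp k l
  choose dA v hv hvv hspan using fun k => (hp k).exists_basis hA
  choose dB w hw hww hpw using fun k => (hp k).isProj.exists_basis
  have hvv' {k l} (hkl : k ≠ l) (a b) : (v k a)ᴴ * v l b = 0 := by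
    have h1 := congrArg Matrix.conjTranspose (hv k a).2
    rw [Matrix.conjTranspose_mul, (hp k).isProj.herm.eq] at h1
    rw [← h1, ← (hv l b).2, mul_assoc, ← mul_assoc _ _ (p l), ← mul_assoc]
    exact hpp k l hkl _ (mul_mem (conjTranspose_mem (hv k a).1) (hv l b).1)
  -- The partial isometries `v k a` supply the `Aₖ` index, and an orthonormal basis of the range of
  -- `p k` the `Bₖ` index.
  let U : Matrix n ((k : Fin K) × (Fin (dA k) × Fin (dB k))) ℂ :=
    Matrix.of fun i x => (v x.1 x.2.1 *ᵥ w x.1 x.2.2) i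
  have hUU : Uᴴ * U = 1 := by
    ext ⟨k, a, b⟩ ⟨l, c, d⟩
    have e : (Uᴴ * U) ⟨k, a, b⟩ ⟨l, c, d⟩ = star (w k b) ⬝ᵥ (((v k a)ᴴ * v l c) *ᵥ w l d) := by
      rw [← Matrix.mulVec_mulVec, Matrix.dotProduct_mulVec, ← Matrix.star_mulVec]
      rfl
    rw [e]
    by_cases hkl : k = l
    · subst hkl
      rw [hvv]
      by_cases hac : a = c
      · rw [if_pos hac, hw, hww]
        simp [Matrix.one_apply, hac]
      · simp [hac]
    · rw [hvv' hkl]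
      simp [hkl]
  have hq1 : ∑ k, ∑ a, v k a * (v k a)ᴴ = 1 := by
    set q := ∑ k, ∑ a, v k a * (v k a)ᴴ with hq
    have hqh : q.IsHermitian := by
      simp [hq, Matrix.IsHermitian, Matrix.conjTranspose_sum]
    have hqA : q ∈ A :=
      sum_mem fun k _ => sum_mem fun a _ => mul_mem (hv k a).1 (conjTranspose_mem (hv k a).1)
    have hqv (l c) : q * v l c = v l c := by
      rw [hq, Finset.sum_mul, Finset.sum_eq_single l]
      · simp [Finset.sum_mul, mul_assoc, hvv, (hv _ _).2]
      · intro k _ hk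
        simp [Finset.sum_mul, mul_assoc, hvv' hk]
      · simp
    have hqq : q * q = q := by
      conv_lhs => enter [2]; rw [hq]
      simp only [Finset.mul_sum, ← mul_assoc, hqv]
      rw [hq]
    have hproj : IsProj q := ⟨hqh, hqq⟩
    -- Otherwise there is a minimal projection `r ≤ 1 - q`. It annihilates all `v l c`, hence every
    -- `r a† p k`, and so is linked to no sector.
    by_contra hne
    obtain ⟨r, hr, hrq⟩ := exists_isMinProj_le hproj.compl (sub_mem (one_mem A) hqA)
      (sub_ne_zero.2 (Ne.symm hne))
    have hrv (l c) : r * v l c = 0 := by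
      rw [← hrq, mul_assoc, sub_mul, one_mul, hqv, sub_self, mul_zero]
    obtain ⟨k, a, ha, hka⟩ := hinter r hr
    refine hka ?_
    obtain ⟨c, hc⟩ := hspan k (r * aᴴ * p k)
      (mul_mem (mul_mem hr.mem (conjTranspose_mem ha)) (hp k).mem)
      (by rw [mul_assoc, (hp k).isProj.idem])
    have h0 : r * aᴴ * p k = 0 := by
      rw [← hr.isProj.idem, mul_assoc, mul_assoc, ← mul_assoc r (aᴴ), hc]
      simp [Finset.mul_sum, hrv]
    simpa [Matrix.conjTranspose_mul, (hp k).isProj.herm.eq, hr.isProj.herm.eq,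
      Matrix.mul_assoc] using congrArg Matrix.conjTranspose h0
  have hUU' : U * Uᴴ = 1 := by
    rw [← hq1]
    have e (k) (a) : v k a * (v k a)ᴴ = v k a * p k * (v k a)ᴴ := by rw [(hv k a).2]
    ext i j
    simp only [e, hpw, Matrix.mul_sum, Matrix.sum_mul, Matrix.mul_vecMulVec, Matrix.vecMulVec_mul,
      ← Matrix.star_mulVec, Matrix.sum_apply, Matrix.vecMulVec_apply]
    rw [Matrix.mul_apply, Fintype.sum_sigma]
    refine Finset.sum_congr rfl fun k _ => ?_
    rw [Fintype.sum_prod_type]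
    rfl
  have hdA (k) : 0 < dA k := by
    obtain ⟨c, hc⟩ := hspan k (p k) (hp k).mem (hp k).isProj.idem
    by_contra h0
    have : IsEmpty (Fin (dA k)) := by rw [Nat.eq_zero_of_not_pos h0]; infer_instance
    exact (hp k).ne_zero (by rw [hc]; simp)
  have hdB (k) : 0 < dB k := by
    by_contra h0
    have : IsEmpty (Fin (dB k)) := by rw [Nat.eq_zero_of_not_pos h0]; infer_instance
    exact (hp k).ne_zero (by rw [hpw k]; simp)
  let D : SectorDecomposition n := ⟨K, dA, dB, hdA, hdB, U, hUU', hUU⟩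
  -- The columns of `U` are `v l c *ᵥ w l d`, so an operator is determined by left multiplication on
  -- the `v l c`.
  have hD (X : (k : Fin K) → Matrix (Fin (dA k)) (Fin (dA k)) ℂ) (M : Matrix n n ℂ)
      (hM : ∀ l c, M * v l c = ∑ a, X l a c • v l a) : D.directSum X (fun _ => 1) = M := by
    have h1 : U * Matrix.blockDiagonal' (fun k => X k ⊗ₖ (1 : Matrix (Fin (dB k)) (Fin (dB k)) ℂ))
        = M * U := by
      ext i ⟨l, c, d⟩
      have e : (M * U) i ⟨l, c, d⟩ = ((M * v l c) *ᵥ w l d) i := by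
        rw [← Matrix.mulVec_mulVec]
        rfl
      rw [e, hM, Matrix.mul_apply, Fintype.sum_sigma, Finset.sum_eq_single l]
      · rw [Fintype.sum_prod_type, Matrix.sum_mulVec, Finset.sum_apply]
        refine Finset.sum_congr rfl fun a _ => ?_
        rw [Finset.sum_eq_single d]
        · simp [Matrix.blockDiagonal'_apply_eq, Matrix.smul_mulVec, U, mul_comm]
        · intro b _ hb
          simp [Matrix.blockDiagonal'_apply_eq, hb]
        · simp
      · intro k _ hk
        simp [Matrix.blockDiagonal'_apply, hk]
      · simp
    change U * _ * Uᴴ = M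
    rw [h1, Matrix.mul_assoc, hUU', Matrix.mul_one]
  refine ⟨D, Set.Subset.antisymm ?_ fun M hM => ?_⟩
  · rintro _ ⟨X, rfl⟩
    change D.directSum X _ ∈ A
    rw [hD X (∑ k, ∑ a, ∑ b, X k a b • (v k a * (v k b)ᴴ))]
    · exact sum_mem fun k _ => sum_mem fun a _ => sum_mem fun b _ =>
        A.smul_mem (mul_mem (hv k a).1 (conjTranspose_mem (hv k b).1)) _
    · intro l c
      rw [Finset.sum_mul, Finset.sum_eq_single l]
      · simp [Finset.sum_mul, mul_assoc, hvv, (hv _ _).2]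
        rfl
      · intro k _ hk
        simp [Finset.sum_mul, mul_assoc, hvv' hk]
      · simp
  · choose c hc using fun k a => hspan k (M * v k a) (mul_mem hM (hv k a).1)
      (by rw [mul_assoc, (hv k a).2])
    exact ⟨fun k => Matrix.of fun b a => c k a b, hD _ M fun l a => hc l a⟩

theorem cfc_mem_centralizer (S : Set (Matrix n n ℂ)) {h : Matrix n n ℂ}
    (hh : h ∈ StarSubalgebra.centralizer ℂ S) (f : ℝ → ℝ) :
    cfc f h ∈ StarSubalgebra.centralizer ℂ S := by
  rw [StarSubalgebra.mem_centralizer_iff] at hh ⊢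
  exact fun g hg => ⟨(Commute.cfc_real (b := g) (hh g hg).1.symm f).symm,
    (Commute.cfc_real (b := star g) (hh g hg).2.symm f).symm⟩

end Structure

/-! ### Ergodic means and noiseless codes -/

section Ergodic

variable {n : Type*} [Fintype n] [DecidableEq n] {E Φ Ψ : Module.End ℂ (Matrix n n ℂ)}
  {x y z : Matrix n n ℂ} {C : Set (Matrix n n ℂ)}

theorem traceNorm_sub_le_add (hx : x.IsHermitian) (hy : y.IsHermitian) :
    traceNorm (x - y) ≤ traceNorm x + traceNorm y := by
  have := traceNorm_add_le hx hy.neg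
  rwa [traceNorm_neg, ← sub_eq_add_neg] at this

theorem pow_apply_eq_of_fixed (hy : E y = y) (hz : E z - z = y) (m : ℕ) :
    (E ^ m) z = z + (m : ℝ) • y := by
  induction m with
  | zero => simp
  | succ m ih =>
    have hz' : E z = y + z := sub_eq_iff_eq_add.1 hz
    rw [pow_succ', Module.End.mul_apply, ih, map_add, LinearMap.map_smul_of_tower, hy, hz',
      Nat.cast_add, add_smul, Nat.cast_one, one_smul]
    abel

/-- Here `Eᵐ z = z + m y` would grow linearly, while the powers of `E` contract the trace norm. -/
theorem IsPositiveTP.eq_zero_of_fixed_of_range (hE : IsPositiveTP E) (hyh : y.IsHermitian)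
    (hzh : z.IsHermitian) (hy : E y = y) (hz : E z - z = y) : y = 0 := by
  refine eq_zero_of_traceNorm hyh (le_antisymm ?_ (traceNorm_nonneg hyh))
  by_contra! hpos
  obtain ⟨m, hm⟩ := exists_nat_gt (2 * traceNorm z / traceNorm y)
  rw [div_lt_iff₀ hpos, ← traceNorm_smul hyh (Nat.cast_nonneg m)] at hm
  have e : (m : ℝ) • y = (E ^ m) z - z := by rw [pow_apply_eq_of_fixed hy hz]; abel
  have h1 := traceNorm_sub_le_add ((hE.pow m).isHermitian hzh) hzh
  have h2 := (hE.pow m).traceNorm_le hzh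
  rw [e] at hm
  linarith

/-- The mean ergodic decomposition of a Hermitian matrix under a positive trace-preserving map. -/
theorem IsPositiveTP.exists_ergodic_decomposition (hE : IsPositiveTP E) (hx : x.IsHermitian) :
    ∃ y z : Matrix n n ℂ, y.IsHermitian ∧ z.IsHermitian ∧ E y = y ∧ x = y + (E z - z) := by
  let V : Submodule ℝ (Matrix n n ℂ) := hermitianFixed LinearMap.id
  have hV {w : Matrix n n ℂ} : w ∈ V ↔ w.IsHermitian := ⟨fun h => h.1, fun h => ⟨h, rfl⟩⟩
  let g : V →ₗ[ℝ] V :=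
    (E.restrictScalars ℝ).restrict (p := V) (q := V)
      (fun w hw => hV.2 (hE.isHermitian (hV.1 hw))) - LinearMap.id
  have hg (w : V) : (g w : Matrix n n ℂ) = E w - w := rfl
  have hdisj : Disjoint (LinearMap.ker g) (LinearMap.range g) := by
    rw [Submodule.disjoint_def]
    rintro u hu ⟨w, hw⟩
    have hu' : E u - u = 0 := by
      rw [← hg, LinearMap.mem_ker.1 hu]
      rfl
    exact Subtype.ext (hE.eq_zero_of_fixed_of_range u.2.1 w.2.1 (sub_eq_zero.1 hu')
      (by rw [← hg, hw]))
  -- Kernel and range of `E - 1` on Hermitian matrices meet trivially and have complementary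
  -- dimensions.
  have htop := Submodule.eq_top_of_disjoint _ _
    (by rw [add_comm, LinearMap.finrank_range_add_finrank_ker]) hdisj
  obtain ⟨u, hu, _, ⟨w, rfl⟩, e⟩ := Submodule.mem_sup.1
    (htop ▸ Submodule.mem_top : (⟨x, hV.2 hx⟩ : V) ∈ LinearMap.ker g ⊔ LinearMap.range g)
  have hu' : E u - u = 0 := by
    rw [← hg, LinearMap.mem_ker.1 hu]
    rfl
  refine ⟨u, w, u.2.1, w.2.1, sub_eq_zero.1 hu', ?_⟩
  rw [← hg, ← Submodule.coe_add, e]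

theorem average_mem_convexHull (E : Module.End ℂ (Matrix n n ℂ)) {m : ℕ} (hm : 0 < m) :
    ∑ k ∈ Finset.range m, (m : ℝ)⁻¹ • E ^ k ∈
      convexHull ℝ (Set.range fun k : ℕ => E ^ k) := by
  refine (convex_convexHull ℝ _).sum_mem (fun _ _ => by positivity) ?_
    fun k _ => subset_convexHull ℝ _ ⟨k, rfl⟩
  rw [Finset.sum_const, Finset.card_range, nsmul_eq_mul, mul_inv_cancel₀]
  exact_mod_cast hm.ne'

/-- The coboundary telescopes, which leaves an error of order `1/m`. -/
theorem average_apply (hy : E y = y) {m : ℕ} (hm : 0 < m) :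
    (∑ k ∈ Finset.range m, (m : ℝ)⁻¹ • E ^ k) (y + (E z - z)) =
      y + (m : ℝ)⁻¹ • ((E ^ m) z - z) := by
  have hpow (k : ℕ) : (E ^ k) y = y := by
    induction k with
    | zero => rfl
    | succ k ih => rw [pow_succ, Module.End.mul_apply, hy, ih]
  have htel : ∑ k ∈ Finset.range m, (E ^ k) (y + (E z - z)) = (m : ℝ) • y + ((E ^ m) z - z) := by
    have e (k : ℕ) : (E ^ k) (y + (E z - z)) = y + ((E ^ (k + 1)) z - (E ^ k) z) := by
      rw [map_add, map_sub, hpow, pow_succ, Module.End.mul_apply]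
    simp only [e, Finset.sum_add_distrib, Finset.sum_const, Finset.card_range]
    rw [Finset.sum_range_sub (fun k => (E ^ k) z)]
    simp [Nat.cast_smul_eq_nsmul]
  rw [← Finset.smul_sum, LinearMap.smul_apply, LinearMap.sum_apply, htel, smul_add, smul_smul,
    inv_mul_cancel₀ (by exact_mod_cast hm.ne'), one_smul]

/-- If all mixtures of powers of `E` preserve the trace norm of `x`, then the trace norm of `x` is
at most that of its ergodic mean. -/
theorem IsPositiveTP.traceNorm_le_of_preserved (hE : IsPositiveTP E) (hyh : y.IsHermitian)
    (hzh : z.IsHermitian) (hy : E y = y)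
    (h : ∀ F ∈ convexHull ℝ (Set.range fun k : ℕ => E ^ k),
      traceNorm (F (y + (E z - z))) = traceNorm (y + (E z - z))) :
    traceNorm (y + (E z - z)) ≤ traceNorm y := by
  refine le_of_forall_pos_le_add fun ε hε => ?_
  obtain ⟨m, hm⟩ := exists_nat_gt (2 * traceNorm z / ε)
  have hz0 := traceNorm_nonneg hzh
  have hm0 : (0 : ℝ) < m := lt_of_le_of_lt (by positivity) hm
  have hm1 : 0 < m := by exact_mod_cast hm0
  rw [← h _ (average_mem_convexHull E hm1), average_apply hy hm1]
  have hH := ((hE.pow m).isHermitian hzh).sub hzh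
  have hH' : ((m : ℝ)⁻¹ • ((E ^ m) z - z)).IsHermitian := by
    simpa using isHermitian_weighted hH hH (m : ℝ)⁻¹ 0
  have h1 := traceNorm_sub_le_add ((hE.pow m).isHermitian hzh) hzh
  have h2 := (hE.pow m).traceNorm_le hzh
  refine (traceNorm_add_le hyh hH').trans ?_
  rw [traceNorm_smul hH (by positivity)]
  rw [div_lt_iff₀ hε] at hm
  have : (m : ℝ)⁻¹ * traceNorm ((E ^ m) z - z) ≤ ε := by
    rw [inv_mul_le_iff₀ hm0]
    linarith
  linarith

/-- Noiseless codes for `E` are preserved by any channel `Φ` that can be followed by a channel onto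
the fixed points of `E`. -/
theorem IsNoiseless.isPreserved (hE : IsPositiveTP E) (hΦ : IsPositiveTP Φ) (hΨ : IsPositiveTP Ψ)
    (hΨE : ∀ X, Ψ (E X) = Ψ X) (hΨfix : ∀ X, E X = X → Ψ X = X) (hΨΦ : ∀ X, Ψ (Φ X) = Ψ X)
    (hC : IsNoiseless E C) : IsPreserved Φ C := by
  intro ρ hρ σ hσ p hp
  have hx := isHermitian_weighted (convexHull_isState hC.1 hρ).1.1
    (convexHull_isState hC.1 hσ).1.1 p (1 - p)
  have hF := fun F hF => hC.2 F hF ρ hρ σ hσ p hp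
  generalize p • ρ - (1 - p) • σ = x at hx hF
  refine le_antisymm (hΦ.traceNorm_le hx) ?_
  obtain ⟨y, z, hy, hz, hEy, rfl⟩ := hE.exists_ergodic_decomposition hx
  refine (hE.traceNorm_le_of_preserved hy hz hEy hF).trans ?_
  -- Since Ψ absorbs both `E` and Φ, it recovers the ergodic mean from the output of Φ, which bounds
  -- the norm of the mean by that of the output.
  have e : y = Ψ (Φ (y + (E z - z))) := by
    rw [hΨΦ, map_add, map_sub, hΨE, sub_self, add_zero, hΨfix y hEy]
  conv_lhs => rw [e]
  exact hΨ.traceNorm_le (hΦ.isHermitian hx)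

/-- The fixed states of a channel that absorbs `E` form a noiseless code for `E`. -/
theorem isNoiseless_fixedStates (hE : IsPositiveTP E) (hΦ : IsPositiveTP Φ)
    (hΦE : ∀ X, Φ (E X) = Φ X) : IsNoiseless E (fixedStates Φ) := by
  refine ⟨fun ρ hρ => hρ.1, fun F hF ρ hρ σ hσ p _ => ?_⟩
  rw [convex_fixedStates.convexHull_eq] at hρ hσ
  have hx := isHermitian_weighted hρ.1.1.1 hσ.1.1.1 p (1 - p)
  have hfix : Φ (p • ρ - (1 - p) • σ) = p • ρ - (1 - p) • σ := by
    rw [map_weighted, hρ.2, hσ.2]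
  generalize p • ρ - (1 - p) • σ = x at hx hfix
  have hFp := hE.of_mem_convexHull hF
  -- Φ undoes every mixture of powers on its own fixed points, so no norm can be lost.
  have hΦF : ∀ X, Φ (F X) = Φ X := by
    have hconv : Convex ℝ {F : Module.End ℂ (Matrix n n ℂ) | ∀ X, Φ (F X) = Φ X} := by
      intro F hF G hG a b _ _ hab X
      rw [LinearMap.add_apply, LinearMap.smul_apply, LinearMap.smul_apply, map_add,
        LinearMap.map_smul_of_tower, LinearMap.map_smul_of_tower, hF, hG, ← add_smul, hab,
        one_smul]
    refine convexHull_min ?_ hconv hF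
    rintro _ ⟨k, rfl⟩ X
    change Φ ((E ^ k) X) = Φ X
    induction k with
    | zero => rfl
    | succ k ih => rw [pow_succ', Module.End.mul_apply, hΦE, ih]
  refine le_antisymm (hFp.traceNorm_le hx) ?_
  conv_lhs => rw [← hfix, ← hΦF]
  exact hΦ.traceNorm_le (hFp.isHermitian hx)

end Ergodic

/-! ### Sector decompositions: direct sums, reduction and reset channels -/

theorem exists_isState {d : ℕ} (hd : 0 < d) : ∃ ρ : Matrix (Fin d) (Fin d) ℂ, IsState ρ := by
  have hd' : (d : ℂ) ≠ 0 := by exact_mod_cast hd.ne'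
  refine ⟨(d : ℂ)⁻¹ • 1, Matrix.PosSemidef.one.smul (by positivity), ?_⟩
  simp [hd']

namespace SectorDecomposition

variable {n : Type*} [Fintype n] [DecidableEq n] (D : SectorDecomposition n)

/-- Families of operators on the noiseless factors. -/
abbrev OpA : Type := (k : Fin D.K) → Matrix (Fin (D.dA k)) (Fin (D.dA k)) ℂ

/-- Families of operators on the noise-full factors. -/
abbrev OpB : Type := (k : Fin D.K) → Matrix (Fin (D.dB k)) (Fin (D.dB k)) ℂ

theorem conj_directSum (X : D.OpA) (Y : D.OpB) :
    D.Uᴴ * D.directSum X Y * D.U = Matrix.blockDiagonal' fun k => X k ⊗ₖ Y k := by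
  rw [directSum, Matrix.mul_assoc, Matrix.mul_assoc _ D.Uᴴ, D.conjTranspose_mul_U, Matrix.mul_one,
    ← Matrix.mul_assoc, D.conjTranspose_mul_U, Matrix.one_mul]

theorem conj_mul (M N : Matrix n n ℂ) :
    D.Uᴴ * (M * N) * D.U = (D.Uᴴ * M * D.U) * (D.Uᴴ * N * D.U) := by
  simp only [Matrix.mul_assoc]
  rw [← Matrix.mul_assoc D.U, D.U_mul_conjTranspose, Matrix.one_mul]

theorem conj_injective {M N : Matrix n n ℂ} (h : D.Uᴴ * M * D.U = D.Uᴴ * N * D.U) : M = N := by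
  have e (Z : Matrix n n ℂ) : D.U * (D.Uᴴ * Z * D.U) * D.Uᴴ = Z := by
    rw [Matrix.mul_assoc D.Uᴴ, ← Matrix.mul_assoc, D.U_mul_conjTranspose, Matrix.one_mul,
      Matrix.mul_assoc, D.U_mul_conjTranspose, Matrix.mul_one]
  rw [← e M, h, e]

theorem directSum_mul (X X' : D.OpA) (Y Y' : D.OpB) :
    D.directSum X Y * D.directSum X' Y' = D.directSum (X * X') (Y * Y') := by
  apply D.conj_injective
  rw [conj_mul, conj_directSum, conj_directSum, conj_directSum, ← Matrix.blockDiagonal'_mul]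
  simp [Matrix.mul_kronecker_mul]

theorem directSum_one_one : D.directSum 1 1 = 1 := by
  apply D.conj_injective
  rw [conj_directSum, Matrix.mul_one, D.conjTranspose_mul_U]
  simp [← Matrix.blockDiagonal'_one]
  rfl

theorem trace_directSum (X : D.OpA) (Y : D.OpB) :
    (D.directSum X Y).trace = ∑ k, (X k).trace * (Y k).trace := by
  rw [directSum, Matrix.trace_mul_cycle, D.conjTranspose_mul_U, Matrix.one_mul,
    Matrix.trace_blockDiagonal']
  simp [Matrix.trace_kronecker]

theorem conjTranspose_directSum (X : D.OpA) (Y : D.OpB) :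
    (D.directSum X Y)ᴴ = D.directSum (fun k => (X k)ᴴ) (fun k => (Y k)ᴴ) := by
  simp [directSum, Matrix.conjTranspose_mul, Matrix.blockDiagonal'_conjTranspose,
    Matrix.conjTranspose_kronecker, Matrix.mul_assoc]

theorem posSemidef_directSum {X : D.OpA} {Y : D.OpB} (hX : ∀ k, (X k).PosSemidef)
    (hY : ∀ k, (Y k).PosSemidef) : (D.directSum X Y).PosSemidef := by
  refine Matrix.PosSemidef.mul_mul_conjTranspose_same ?_ D.U
  choose x hx using fun k => CStarAlgebra.nonneg_iff_eq_star_mul_self.mp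
    ((hX k).kronecker (hY k)).nonneg
  simp only [hx, Matrix.blockDiagonal'_mul, Matrix.star_eq_conjTranspose,
    ← Matrix.blockDiagonal'_conjTranspose]
  exact Matrix.posSemidef_conjTranspose_mul_self _

/-- `X ↦ ⨁ₖ Xₖ ⊗ Yₖ` as a linear map. -/
def directSumₗ (Y : D.OpB) : D.OpA →ₗ[ℂ] Matrix n n ℂ where
  toFun X := D.directSum X Y
  map_add' X X' := by
    simp [directSum, Matrix.add_kronecker, ← Matrix.mul_add, ← Matrix.add_mul,
      ← Matrix.blockDiagonal'_add]
    rfl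
  map_smul' c X := by
    have e : (Matrix.blockDiagonal' fun k => (c • X) k ⊗ₖ Y k) =
        c • Matrix.blockDiagonal' fun k => X k ⊗ₖ Y k := by
      rw [← Matrix.blockDiagonal'_smul]
      exact congrArg Matrix.blockDiagonal' (funext fun k => Matrix.smul_kronecker c (X k) (Y k))
    change D.U * Matrix.blockDiagonal' (fun k => (c • X) k ⊗ₖ Y k) * D.Uᴴ = _
    rw [e, Matrix.mul_smul, Matrix.smul_mul]
    rfl

@[simp] theorem directSumₗ_apply (X : D.OpA) (Y : D.OpB) : D.directSumₗ Y X = D.directSum X Y := rfl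

/-- Restriction to the diagonal blocks followed by the partial trace over the noise-full
factors. -/
def reduce : Matrix n n ℂ →ₗ[ℂ] D.OpA where
  toFun M k := ∑ b, (D.Uᴴ * M * D.U).submatrix (fun a => ⟨k, a, b⟩) fun a => ⟨k, a, b⟩
  map_add' M N := by
    ext k i j
    simp [Matrix.mul_add, Matrix.add_mul, Finset.sum_add_distrib, Matrix.sum_apply]
  map_smul' c M := by
    ext k i j
    simp [Finset.mul_sum, Matrix.sum_apply]

theorem reduce_apply (M : Matrix n n ℂ) (k : Fin D.K) (a a' : Fin (D.dA k)) :
    D.reduce M k a a' = ∑ b, (D.Uᴴ * M * D.U) ⟨k, a, b⟩ ⟨k, a', b⟩ := by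
  simp [reduce, Matrix.sum_apply]

theorem posSemidef_reduce {M : Matrix n n ℂ} (hM : M.PosSemidef) (k : Fin D.K) :
    (D.reduce M k).PosSemidef :=
  Matrix.posSemidef_sum _ fun _ _ => (hM.conjTranspose_mul_mul_same D.U).submatrix _

theorem reduce_directSum (X : D.OpA) (Y : D.OpB) (k : Fin D.K) :
    D.reduce (D.directSum X Y) k = (Y k).trace • X k := by
  ext a a'
  rw [reduce_apply, conj_directSum]
  simp [Matrix.blockDiagonal'_apply_eq, Matrix.trace, ← Finset.mul_sum, mul_comm]

/-- `reduce` is the trace dual of `X ↦ ⨁ Xₖ ⊗ 1`; this carries facts about `E†` on the algebra over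
to `E`. -/
theorem trace_directSum_one_mul (X : D.OpA) (M : Matrix n n ℂ) :
    (D.directSum X 1 * M).trace = ∑ k, (X k * D.reduce M k).trace := by
  have e : (D.directSum X 1 * M).trace =
      ((Matrix.blockDiagonal' fun k => X k ⊗ₖ (1 : D.OpB) k) *
        (D.Uᴴ * M * D.U)).trace := by
    rw [← conj_directSum, ← conj_mul, Matrix.trace_mul_cycle, ← Matrix.mul_assoc,
      D.U_mul_conjTranspose, Matrix.one_mul]
  rw [e, Matrix.trace, Fintype.sum_sigma]
  refine Finset.sum_congr rfl fun k _ => ?_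
  rw [Fintype.sum_prod_type, Matrix.trace]
  refine Finset.sum_congr rfl fun a _ => ?_
  simp only [Matrix.diag_apply, Matrix.mul_apply, reduce_apply, Finset.mul_sum]
  conv_rhs => rw [Finset.sum_comm]
  refine Finset.sum_congr rfl fun b _ => ?_
  rw [Fintype.sum_sigma, Finset.sum_eq_single k]
  · rw [Fintype.sum_prod_type]
    refine Finset.sum_congr rfl fun a' _ => ?_
    rw [Finset.sum_eq_single b]
    · simp [Matrix.blockDiagonal'_apply_eq]
    · intro b' _ hb
      simp [Matrix.blockDiagonal'_apply_eq, hb.symm]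
    · simp
  · intro l _ hl
    simp [Matrix.blockDiagonal'_apply, hl.symm]
  · simp

theorem sum_trace_reduce (M : Matrix n n ℂ) : ∑ k, (D.reduce M k).trace = M.trace := by
  have := D.trace_directSum_one_mul 1 M
  rw [directSum_one_one, Matrix.one_mul] at this
  simpa using this.symm

/-- The channel that restricts to the diagonal blocks and resets the noise-full factors to `μ`. -/
def channel (μ : D.OpB) : Matrix n n ℂ →ₗ[ℂ] Matrix n n ℂ :=
  D.directSumₗ μ ∘ₗ D.reduce

theorem channel_apply (μ : D.OpB) (M : Matrix n n ℂ) :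
    D.channel μ M = D.directSum (D.reduce M) μ := rfl

variable {D} {μ ν : D.OpB}

theorem reduce_directSum_of_isState (hμ : ∀ k, IsState (μ k)) (X : D.OpA) :
    D.reduce (D.directSum X μ) = X := by
  ext1 k
  rw [reduce_directSum, (hμ k).2, one_smul]

theorem reduce_channel (hμ : ∀ k, IsState (μ k)) (M : Matrix n n ℂ) :
    D.reduce (D.channel μ M) = D.reduce M :=
  reduce_directSum_of_isState hμ _

theorem isPositiveTP_channel (hμ : ∀ k, IsState (μ k)) : IsPositiveTP (D.channel μ) where
  pos M hM := D.posSemidef_directSum (D.posSemidef_reduce hM) fun k => (hμ k).1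
  trace M := by
    rw [channel_apply, trace_directSum, ← D.sum_trace_reduce M]
    simp [(hμ _).2]

/-- For `μ = ν` this is idempotence; in general it makes two reset channels mutually inverse between
their sets of fixed states. -/
theorem channel_channel (hν : ∀ k, IsState (ν k)) (M : Matrix n n ℂ) :
    D.channel μ (D.channel ν M) = D.channel μ M := by
  rw [channel_apply, reduce_channel hν, channel_apply]

theorem mem_code_of_eq (hμ : ∀ k, IsState (μ k)) {M : Matrix n n ℂ} (hM : IsState M)
    {X : D.OpA} (h : M = D.directSum X μ) : M ∈ D.code μ := by
  have hX : X = D.reduce M := by rw [h, reduce_directSum_of_isState hμ]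
  have hP (k) : (X k).PosSemidef := hX ▸ D.posSemidef_reduce hM.1 k
  -- Every state is fixed by the identity; an arbitrary state fills the sectors of weight zero.
  choose ρ hρ e using fun k => exists_fixedStates_smul (Φ := LinearMap.id)
    (let ⟨σ, hσ⟩ := exists_isState (D.dA_pos k); ⟨σ, hσ, rfl⟩) (hP k) rfl
  refine ⟨fun k => (X k).trace.re, ρ, fun k => (hP k).trace_re_nonneg, ?_, fun k => (hρ k).1, ?_⟩
  · rw [← Complex.re_sum, hX, D.sum_trace_reduce, hM.trace_re]
  · rw [h]
    congr 1
    exact funext e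

theorem code_eq_fixedStates (hμ : ∀ k, IsState (μ k)) : D.code μ = fixedStates (D.channel μ) := by
  ext M
  constructor
  · rintro ⟨p, ρ, hp, hsum, hρ, rfl⟩
    have hr (k) : p k • ρ k = (p k : ℂ) • ρ k := by ext; simp
    refine ⟨⟨D.posSemidef_directSum (fun k => ?_) fun k => (hμ k).1, ?_⟩, ?_⟩
    · rw [hr]
      exact (hρ k).1.smul (by exact_mod_cast hp k)
    · rw [trace_directSum]
      simp only [hr, Matrix.trace_smul, (hρ _).2, (hμ _).2, smul_eq_mul, mul_one]
      rw [← Complex.ofReal_sum, hsum, Complex.ofReal_one]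
    · rw [channel_apply, reduce_directSum_of_isState hμ]
  · rintro ⟨hM, hfix⟩
    exact mem_code_of_eq hμ hM hfix.symm

end SectorDecomposition

/-! ### Matrix units, commutant and twirl -/

namespace SectorDecomposition

variable {n : Type*} [Fintype n] [DecidableEq n] (D : SectorDecomposition n)

/-- The matrix units of the algebra `⨁ₖ M(Aₖ) ⊗ 1`. -/
def unit (k : Fin D.K) (a c : Fin (D.dA k)) : Matrix n n ℂ :=
  D.directSum (Pi.single k (Matrix.single a c 1)) 1

theorem unit_mul_unit_same (k : Fin D.K) (a c c' d : Fin (D.dA k)) :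
    D.unit k a c * D.unit k c' d = if c = c' then D.unit k a d else 0 := by
  rw [unit, unit, directSum_mul, ← Pi.single_mul, mul_one]
  split_ifs with h
  · subst h
    rw [Matrix.single_mul_single_same, mul_one, unit]
  · rw [Matrix.single_mul_single_of_ne _ _ _ _ h, Pi.single_zero, ← directSumₗ_apply, map_zero]

theorem unit_mul_unit_of_ne {k l : Fin D.K} (h : k ≠ l) (a c : Fin (D.dA k))
    (c' d : Fin (D.dA l)) : D.unit k a c * D.unit l c' d = 0 := by
  have e : (Pi.single k (Matrix.single a c 1) : D.OpA) * Pi.single l (Matrix.single c' d 1) = 0 := by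
    ext1 j
    rcases eq_or_ne j k with rfl | hj
    · simp [h]
    · simp [hj]
  rw [unit, unit, directSum_mul, e, ← directSumₗ_apply, map_zero]

theorem conjTranspose_unit (k : Fin D.K) (a c : Fin (D.dA k)) :
    (D.unit k a c)ᴴ = D.unit k c a := by
  rw [unit, conjTranspose_directSum, unit]
  congr 1
  · ext1 j
    rcases eq_or_ne j k with rfl | hj
    · simp
    · simp [hj]
  · ext1 j
    simp

theorem unit_ne_zero (k : Fin D.K) (a c : Fin (D.dA k)) : D.unit k a c ≠ 0 := by
  intro h
  have h1 := congrFun (congrArg D.reduce h) k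
  rw [unit, reduce_directSum, map_zero, Pi.single_eq_same] at h1
  have h2 := congrFun (congrFun h1 a) c
  have : (D.dB k : ℂ) ≠ 0 := by exact_mod_cast (D.dB_pos k).ne'
  simp [this] at h2

theorem conj_unit_mul_apply (k : Fin D.K) (a c : Fin (D.dA k)) (b : Fin (D.dB k))
    (M : Matrix n n ℂ) (y) :
    (D.Uᴴ * (D.unit k a c * M) * D.U) ⟨k, a, b⟩ y = (D.Uᴴ * M * D.U) ⟨k, c, b⟩ y := by
  rw [conj_mul, unit, conj_directSum, Matrix.mul_apply, Finset.sum_eq_single ⟨k, c, b⟩]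
  · simp [Matrix.blockDiagonal'_apply_eq]
  · rintro ⟨l, c', d⟩ _ hne
    by_cases hl : k = l
    · subst hl
      by_cases hc : c = c'
      · subst hc
        have hd : b ≠ d := fun h => hne (by rw [h])
        simp [Matrix.blockDiagonal'_apply_eq, hd]
      · simp [Matrix.blockDiagonal'_apply_eq, hc]
    · simp [Matrix.blockDiagonal'_apply, hl]
  · simp

theorem conj_mul_unit_apply_same (k : Fin D.K) (a c : Fin (D.dA k)) (d : Fin (D.dB k))
    (M : Matrix n n ℂ) (x) :
    (D.Uᴴ * (M * D.unit k a c) * D.U) x ⟨k, c, d⟩ = (D.Uᴴ * M * D.U) x ⟨k, a, d⟩ := by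
  rw [conj_mul, unit, conj_directSum, Matrix.mul_apply, Finset.sum_eq_single ⟨k, a, d⟩]
  · simp [Matrix.blockDiagonal'_apply_eq]
  · rintro ⟨l, c', d'⟩ _ hne
    by_cases hl : l = k
    · subst hl
      by_cases hc : a = c'
      · subst hc
        have hd : d' ≠ d := fun h => hne (by rw [h])
        simp [Matrix.blockDiagonal'_apply_eq, hd]
      · simp [Matrix.blockDiagonal'_apply_eq, hc]
    · simp [Matrix.blockDiagonal'_apply, hl]
  · simp

theorem conj_mul_unit_apply_of_ne (k : Fin D.K) (a c : Fin (D.dA k)) (M : Matrix n n ℂ) (x)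
    (l : Fin D.K) (c' : Fin (D.dA l)) (d : Fin (D.dB l))
    (h : (⟨k, c⟩ : (k : Fin D.K) × Fin (D.dA k)) ≠ ⟨l, c'⟩) :
    (D.Uᴴ * (M * D.unit k a c) * D.U) x ⟨l, c', d⟩ = 0 := by
  rw [conj_mul, unit, conj_directSum, Matrix.mul_apply]
  refine Finset.sum_eq_zero ?_
  rintro ⟨l', c'', d'⟩ _
  by_cases hl : l' = l
  · subst hl
    by_cases hk : l' = k
    · subst hk
      have hc : c ≠ c' := fun h' => h (by rw [h'])
      simp [Matrix.blockDiagonal'_apply_eq, hc]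
    · simp [Matrix.blockDiagonal'_apply_eq, hk]
  · simp [Matrix.blockDiagonal'_apply, hl]

/-- The commutant of `⨁ₖ M(Aₖ) ⊗ 1` is `⨁ₖ 1 ⊗ M(Bₖ)`. -/
theorem exists_eq_directSum_one {M : Matrix n n ℂ}
    (h : ∀ k a c, D.unit k a c * M = M * D.unit k a c) :
    ∃ Y : D.OpB, M = D.directSum 1 Y ∧ (M.PosSemidef → ∀ k, (Y k).PosSemidef) := by
  let a0 (k : Fin D.K) : Fin (D.dA k) := ⟨0, D.dA_pos k⟩
  refine ⟨fun k => (D.Uᴴ * M * D.U).submatrix (fun b => ⟨k, a0 k, b⟩) fun b => ⟨k, a0 k, b⟩, ?_,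
    fun hM k => (hM.conjTranspose_mul_mul_same D.U).submatrix _⟩
  apply D.conj_injective
  rw [conj_directSum]
  ext ⟨k, c, b⟩ ⟨l, c', d⟩
  -- Multiplying by the unit `(a0, c)` moves the row index `c` to `a0`; commuting it to the other
  -- side forces the column to lie in `(k, c)` and moves it to `a0` too.
  rw [← D.conj_unit_mul_apply k (a0 k) c b, h]
  by_cases hkl : (⟨k, c⟩ : (k : Fin D.K) × Fin (D.dA k)) = ⟨l, c'⟩
  · obtain ⟨rfl, h2⟩ := Sigma.mk.inj_iff.1 hkl
    obtain rfl := eq_of_heq h2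
    rw [conj_mul_unit_apply_same]
    simp [Matrix.blockDiagonal'_apply_eq]
  · rw [D.conj_mul_unit_apply_of_ne k (a0 k) c _ _ l c' d hkl]
    by_cases hk : k = l
    · subst hk
      have hc : c ≠ c' := fun h' => hkl (by rw [h'])
      simp [Matrix.blockDiagonal'_apply_eq, hc]
    · simp [Matrix.blockDiagonal'_apply, hk]

/-- Averaging over the matrix units gives an element of the commutant. -/
def twirl (M : Matrix n n ℂ) : Matrix n n ℂ :=
  ∑ k, ∑ a, ∑ c, D.unit k a c * M * D.unit k c a

theorem unit_mul_twirl (M : Matrix n n ℂ) (l : Fin D.K) (i j : Fin (D.dA l)) :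
    D.unit l i j * D.twirl M = ∑ c, D.unit l i c * M * D.unit l c j := by
  simp only [twirl, Finset.mul_sum, ← mul_assoc]
  rw [Finset.sum_eq_single l]
  · rw [Finset.sum_eq_single j]
    · simp [unit_mul_unit_same]
    · intro a _ ha
      simp [unit_mul_unit_same, ha.symm]
    · simp
  · intro k _ hk
    simp [D.unit_mul_unit_of_ne hk.symm]
  · simp

theorem twirl_mul_unit (M : Matrix n n ℂ) (l : Fin D.K) (i j : Fin (D.dA l)) :
    D.twirl M * D.unit l i j = ∑ c, D.unit l i c * M * D.unit l c j := by
  simp only [twirl, Finset.sum_mul, mul_assoc]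
  rw [Finset.sum_eq_single l]
  · rw [Finset.sum_eq_single i]
    · simp [unit_mul_unit_same]
    · intro a _ ha
      simp [unit_mul_unit_same, ha]
    · simp
  · intro k _ hk
    simp [D.unit_mul_unit_of_ne hk]
  · simp

/-- The twirl of a positive definite matrix is `⨁ₖ 1 ⊗ Tₖ` with all `Tₖ` positive and nonzero. -/
theorem exists_twirl_eq {ρ : Matrix n n ℂ} (hρ : ρ.PosDef) :
    ∃ T : D.OpB, D.twirl ρ = D.directSum 1 T ∧ (∀ k, (T k).PosSemidef) ∧ ∀ k, T k ≠ 0 := by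
  have hterm (k) (a c) : (D.unit k a c * ρ * D.unit k c a).PosSemidef := by
    rw [← D.conjTranspose_unit k a c]
    exact hρ.posSemidef.mul_mul_conjTranspose_same _
  have hpos : (D.twirl ρ).PosSemidef :=
    Matrix.posSemidef_sum _ fun k _ => Matrix.posSemidef_sum _ fun a _ =>
      Matrix.posSemidef_sum _ fun c _ => hterm k a c
  obtain ⟨T, hT, hTpos⟩ := D.exists_eq_directSum_one (M := D.twirl ρ) fun k a c => by
    rw [unit_mul_twirl, twirl_mul_unit]
  refine ⟨T, hT, hTpos hpos, fun k hk => ?_⟩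
  let a : Fin (D.dA k) := ⟨0, D.dA_pos k⟩
  -- A vanishing `T k` would kill this sum of positive terms, in particular the term `c = a`,
  -- against faithfulness of ρ.
  have h0 : ∑ c, D.unit k a c * ρ * D.unit k c a = 0 := by
    rw [← unit_mul_twirl, hT, unit, directSum_mul, mul_one, one_mul]
    apply D.conj_injective
    rw [conj_directSum, Matrix.mul_zero, Matrix.zero_mul, ← Matrix.blockDiagonal'_zero]
    congr 1
    ext1 l
    rcases eq_or_ne l k with rfl | hl
    · simp [hk]
    · simp [hl]
  have h1 := (Finset.sum_eq_zero_iff_of_nonneg fun c _ => (hterm k a c).nonneg).1 h0 a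
    (Finset.mem_univ a)
  refine D.unit_ne_zero k a a (hρ.eq_zero_of_mul_mul_conjTranspose ?_)
  rwa [conjTranspose_unit]

end SectorDecomposition

/-! ### Fixed points of the channel -/

section FixedPoints

variable {n : Type*} [Fintype n] [DecidableEq n] {E : Matrix n n ℂ →ₗ[ℂ] Matrix n n ℂ}

/-- A linear map on matrices and its adjoint have fixed-point spaces of the same dimension. -/
theorem finrank_fixed_adjointMap (E : Matrix n n ℂ →ₗ[ℂ] Matrix n n ℂ) :
    Module.finrank ℂ (LinearMap.ker (adjointMap E - LinearMap.id)) =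
      Module.finrank ℂ (LinearMap.ker (E - LinearMap.id)) := by
  -- The trace pairing identifies `E†` with the transpose of `E`, so the ranks of `E† - 1` and `E -
  -- 1` agree.
  let B : Matrix n n ℂ →ₗ[ℂ] Module.Dual ℂ (Matrix n n ℂ) :=
    (LinearMap.mul ℂ (Matrix n n ℂ)).compr₂ (Matrix.traceLinearMap n ℂ ℂ)
  have hB (X Y : Matrix n n ℂ) : B X Y = (X * Y).trace := rfl
  have hinj : Function.Injective B := fun X Y h =>
    Matrix.ext_iff_trace_mul_right.2 fun Z => by rw [← hB, h, hB]
  let T : Matrix n n ℂ ≃ₗ[ℂ] Module.Dual ℂ (Matrix n n ℂ) :=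
    LinearEquiv.ofInjectiveOfFinrankEq B hinj Subspace.dual_finrank_eq.symm
  have hT (X Y : Matrix n n ℂ) : T X Y = (X * Y).trace := rfl
  have hcomp : T.toLinearMap ∘ₗ (adjointMap E - LinearMap.id) =
      (E - LinearMap.id).dualMap ∘ₗ T.toLinearMap := by
    refine LinearMap.ext fun X => LinearMap.ext fun Y => ?_
    simp [hT, LinearMap.dualMap_apply, Matrix.mul_sub, trace_adjointMap_mul]
  have h1 : Module.finrank ℂ (LinearMap.range (adjointMap E - LinearMap.id)) =
      Module.finrank ℂ (LinearMap.range (E - LinearMap.id)) := by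
    have e : LinearMap.range ((E - LinearMap.id).dualMap ∘ₗ T.toLinearMap) =
        LinearMap.range (E - LinearMap.id).dualMap :=
      LinearMap.range_comp_of_range_eq_top _ T.range
    rw [← LinearMap.finrank_range_dualMap_eq_finrank_range (E - LinearMap.id), ← e, ← hcomp,
      LinearMap.range_comp]
    exact (LinearEquiv.finrank_map_eq T _).symm
  have h2 := LinearMap.finrank_range_add_finrank_ker (adjointMap E - LinearMap.id)
  have h3 := LinearMap.finrank_range_add_finrank_ker (E - LinearMap.id)
  omega

namespace SectorDecomposition

variable {D : SectorDecomposition n}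

theorem reduce_map_of_adjoint_fixed
    (h : ∀ X : D.OpA, adjointMap E (D.directSum X 1) = D.directSum X 1) (M : Matrix n n ℂ) :
    D.reduce (E M) = D.reduce M := by
  ext k a c
  have h1 := D.trace_directSum_one_mul (Pi.single k (Matrix.single c a 1)) (E M)
  have h2 := D.trace_directSum_one_mul (Pi.single k (Matrix.single c a 1)) M
  rw [← trace_adjointMap_mul, h, h2] at h1
  have e (Z : D.OpA) : ∑ l, ((Pi.single k (Matrix.single c a 1) : D.OpA) l * Z l).trace =
      Z k a c := by
    rw [Finset.sum_eq_single k]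
    · simp [Matrix.trace_single_mul]
    · intro l _ hl
      simp [hl]
    · simp
  rw [e, e] at h1
  exact h1.symm

variable {ι : Type*} [Fintype ι] {K : ι → Matrix n n ℂ} {ρ : Matrix n n ℂ}

/-- Elements of the commutant pass through the Kraus operators on either side, so they turn fixed
points of the channel into fixed points. -/
theorem krausMap_mul_mul {x y : Matrix n n ℂ} (hx : x ∈ StarSubalgebra.centralizer ℂ (Set.range K))
    (hy : y ∈ StarSubalgebra.centralizer ℂ (Set.range K)) (M : Matrix n n ℂ) :
    krausMap K (x * M * y) = x * krausMap K M * y := by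
  rw [StarSubalgebra.mem_centralizer_iff] at hx hy
  rw [krausMap_apply, krausMap_apply, Finset.mul_sum, Finset.sum_mul]
  refine Finset.sum_congr rfl fun i _ => ?_
  have h1 := (hx (K i) ⟨i, rfl⟩).1
  have h2 := (hy (K i) ⟨i, rfl⟩).2
  rw [Matrix.star_eq_conjTranspose] at h2
  rw [← mul_assoc, ← mul_assoc, h1, mul_assoc _ y, ← h2]
  simp only [mul_assoc]

/-- In the presence of a faithful fixed state, the fixed points of a channel are the fixed points
of one of the reset channels of the sector decomposition. -/
theorem exists_channel_fixed (h : IsTracePreserving (krausMap K)) (hρ : ρ.PosDef)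
    (hfix : krausMap K ρ = ρ)
    (hD : D.algebra = (StarSubalgebra.centralizer ℂ (Set.range K) : Set (Matrix n n ℂ))) :
    ∃ τ : D.OpB, (∀ k, IsState (τ k)) ∧ ∀ Y, krausMap K Y = Y → D.channel τ Y = Y := by
  have hmem (X : D.OpA) : D.directSum X 1 ∈ StarSubalgebra.centralizer ℂ (Set.range K) := by
    rw [← SetLike.mem_coe, ← hD]
    exact ⟨X, rfl⟩
  obtain ⟨T, hT, hTpos, hT0⟩ := D.exists_twirl_eq hρ
  have htw : krausMap K (D.twirl ρ) = D.twirl ρ := by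
    simp only [twirl, map_sum]
    refine Finset.sum_congr rfl fun k _ => Finset.sum_congr rfl fun a _ =>
      Finset.sum_congr rfl fun c _ => ?_
    rw [unit, unit, krausMap_mul_mul (hmem _) (hmem _), hfix]
  have ht0 (k) : (T k).trace.re ≠ 0 := fun h0 => hT0 k ((hTpos k).eq_zero_of_trace_re h0)
  have hrange : LinearMap.range (D.directSumₗ T) ≤ LinearMap.ker (krausMap K - LinearMap.id) := by
    rintro _ ⟨X, rfl⟩
    have e : D.directSum X T = D.directSum X 1 * D.twirl ρ * 1 := by
      rw [hT, directSum_mul, mul_one, one_mul, mul_one]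
    rw [LinearMap.mem_ker, LinearMap.sub_apply, sub_eq_zero, directSumₗ_apply, e,
      krausMap_mul_mul (hmem X) (one_mem _), htw]
    rfl
  have hinj : Function.Injective (D.directSumₗ T) := by
    intro X X' hXX
    ext1 k
    have := congrFun (congrArg D.reduce hXX) k
    rw [directSumₗ_apply, directSumₗ_apply, reduce_directSum, reduce_directSum] at this
    refine smul_right_injective _ (fun h0 => ht0 k ?_) this
    rw [h0, Complex.zero_re]
  have hle : LinearMap.ker (adjointMap (krausMap K) - LinearMap.id) ≤
      LinearMap.range (D.directSumₗ 1) := by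
    intro X hX
    rw [LinearMap.mem_ker, LinearMap.sub_apply, sub_eq_zero] at hX
    have : X ∈ (StarSubalgebra.centralizer ℂ (Set.range K) : Set (Matrix n n ℂ)) :=
      (mem_centralizer_iff_adjoint_fixed h hρ hfix).2 hX
    rw [← hD] at this
    exact this
  -- The family `⨁ Xₖ ⊗ Tₖ` already has the dimension of the algebra, which bounds that of the fixed
  -- points of `E†` and hence of `E`.
  have heq := Submodule.eq_of_le_of_finrank_le hrange (by
    rw [← finrank_fixed_adjointMap, LinearMap.finrank_range_of_inj hinj]
    exact (Submodule.finrank_mono hle).trans (LinearMap.finrank_range_le _))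
  choose τ hτ hTτ using fun k => exists_fixedStates_smul (Φ := LinearMap.id)
    (let ⟨σ, hσ⟩ := exists_isState (D.dB_pos k); ⟨σ, hσ, rfl⟩) (hTpos k) rfl
  refine ⟨τ, fun k => (hτ k).1, fun Y hY => ?_⟩
  have : Y ∈ LinearMap.range (D.directSumₗ T) := by
    rw [heq, LinearMap.mem_ker, LinearMap.sub_apply, hY]
    exact sub_self _
  obtain ⟨X, rfl⟩ := this
  have e : D.directSum X T = D.directSum (fun k => (T k).trace.re • X k) τ := by
    rw [directSum, directSum]
    congr 3
    ext1 k
    conv_lhs => rw [hTτ k]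
    rw [Matrix.smul_kronecker, Matrix.kronecker_smul]
  rw [directSumₗ_apply, e, channel_apply, reduce_directSum_of_isState fun k => (hτ k).1]

end SectorDecomposition

end FixedPoints

/-! ### Rigidity and isometry of codes -/

theorem exists_spectral_projections {m : Type*} [Fintype m] [DecidableEq m] {H : Matrix m m ℂ}
    (hH : H.IsHermitian) :
    ∃ (t : m → ℝ) (P : m → Matrix m m ℂ), (∀ j, IsProj (P j)) ∧ H = ∑ j, t j • P j ∧
      (H.PosSemidef → ∀ j, 0 ≤ t j) := by
  let V : Matrix m m ℂ := hH.eigenvectorUnitary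
  have hV : Vᴴ * V = 1 := Unitary.coe_star_mul_self hH.eigenvectorUnitary
  refine ⟨hH.eigenvalues, fun j => V * Matrix.single j j 1 * Vᴴ, fun j => ⟨?_, ?_⟩, ?_,
    fun h => h.eigenvalues_nonneg⟩
  · simp [Matrix.IsHermitian, Matrix.conjTranspose_mul, Matrix.mul_assoc]
  · calc V * Matrix.single j j 1 * Vᴴ * (V * Matrix.single j j 1 * Vᴴ)
        = V * Matrix.single j j 1 * (Vᴴ * V) * Matrix.single j j 1 * Vᴴ := by
          simp only [Matrix.mul_assoc]
      _ = V * Matrix.single j j 1 * Vᴴ := by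
          rw [hV, Matrix.mul_one, Matrix.mul_assoc V, Matrix.single_mul_single_same, one_mul]
  · conv_lhs => rw [hH.spectral_theorem]
    rw [Unitary.conjStarAlgAut_apply]
    have e : Matrix.diagonal (RCLike.ofReal ∘ hH.eigenvalues : m → ℂ) =
        ∑ j, hH.eigenvalues j • Matrix.single j j 1 := by
      ext a b
      simp [Matrix.diagonal_apply, Matrix.sum_apply, Matrix.single_apply, ite_and]
    rw [e, Matrix.mul_sum, Matrix.sum_mul]
    simp only [Matrix.mul_smul, Matrix.smul_mul]
    rfl

namespace SectorDecomposition

variable {n : Type*} [Fintype n] [DecidableEq n] {D : SectorDecomposition n}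
  {C : Set (Matrix n n ℂ)}

variable (C) in
/-- The nonnegative multiples of the elements of a set. -/
def cone : Set (Matrix n n ℂ) := {M | ∃ t : ℝ, 0 ≤ t ∧ ∃ c ∈ C, M = t • c}

theorem cone_add (hC : Convex ℝ C) {M N : Matrix n n ℂ} (hM : M ∈ cone C) (hN : N ∈ cone C) :
    M + N ∈ cone C := by
  obtain ⟨t, ht, c, hc, rfl⟩ := hM
  obtain ⟨s, hs, d, hd, rfl⟩ := hN
  rcases (add_nonneg ht hs).eq_or_lt with h | h
  · exact ⟨0, le_rfl, c, hc, by simp [show t = 0 by linarith, show s = 0 by linarith]⟩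
  · refine ⟨t + s, h.le, _, hC hc hd (div_nonneg ht h.le) (div_nonneg hs h.le)
      (by rw [← add_div, div_self h.ne']), ?_⟩
    rw [smul_add, smul_smul, smul_smul, mul_div_cancel₀ _ h.ne', mul_div_cancel₀ _ h.ne']

theorem cone_smul {M : Matrix n n ℂ} (hM : M ∈ cone C) {s : ℝ} (hs : 0 ≤ s) : s • M ∈ cone C := by
  obtain ⟨t, ht, c, hc, rfl⟩ := hM
  exact ⟨s * t, mul_nonneg hs ht, c, hc, smul_smul _ _ _⟩

theorem cone_sum (hC : Convex ℝ C) (hne : C.Nonempty) {ι : Type*} (s : Finset ι)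
    {f : ι → Matrix n n ℂ} (hf : ∀ i ∈ s, f i ∈ cone C) : ∑ i ∈ s, f i ∈ cone C :=
  Finset.sum_induction f (· ∈ cone C) (fun _ _ => cone_add hC)
    (let ⟨c, hc⟩ := hne; ⟨0, le_rfl, c, hc, by simp⟩) hf

theorem posSemidef_of_mem_cone (hst : ∀ c ∈ C, IsState c) {M : Matrix n n ℂ} (hM : M ∈ cone C) :
    M.PosSemidef := by
  obtain ⟨t, ht, c, hc, rfl⟩ := hM
  have e : t • c = (t : ℂ) • c := by ext; simp
  rw [e]
  exact (hst c hc).1.smul (by exact_mod_cast ht)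

/-- Reduction keeps the trace, so it determines the scale factor, and injectivity on `C` does the
rest. -/
theorem cone_injOn_reduce (hst : ∀ c ∈ C, IsState c) (hinj : Set.InjOn D.reduce C) :
    Set.InjOn D.reduce (cone C) := by
  rintro _ ⟨t, ht, c, hc, rfl⟩ _ ⟨s, hs, d, hd, rfl⟩ h
  have hts : t = s := by
    have h1 := D.sum_trace_reduce (t • c)
    rw [h, D.sum_trace_reduce, Matrix.trace_smul, Matrix.trace_smul, (hst c hc).2,
      (hst d hd).2] at h1
    simpa using h1.symm
  subst hts
  rcases ht.eq_or_lt with h0 | h0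
  · simp [← h0]
  · rw [LinearMap.map_smul_of_tower, LinearMap.map_smul_of_tower] at h
    rw [hinj hc hd (smul_right_injective _ h0.ne' h)]

theorem cone_surjOn_reduce (hne : C.Nonempty)
    (hsurj : ∀ Y : D.OpA, (∀ k, (Y k).PosSemidef) → ∑ k, (Y k).trace = 1 →
      ∃ c ∈ C, D.reduce c = Y) {Y : D.OpA} (hY : ∀ k, (Y k).PosSemidef) :
    ∃ M ∈ cone C, D.reduce M = Y := by
  have hnn (k) := (hY k).trace_re_nonneg
  have htr : ∑ k, (Y k).trace = ((∑ k, (Y k).trace.re : ℝ) : ℂ) := by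
    rw [Complex.ofReal_sum]
    exact Finset.sum_congr rfl fun k _ => (hY k).trace_eq_re
  rcases (Finset.sum_nonneg fun k _ => hnn k : 0 ≤ ∑ k, (Y k).trace.re).eq_or_lt with h | h
  · obtain ⟨c, hc⟩ := hne
    refine ⟨0, ⟨0, le_rfl, c, hc, by simp⟩, ?_⟩
    rw [map_zero]
    ext1 k
    exact ((hY k).eq_zero_of_trace_re
      ((Finset.sum_eq_zero_iff_of_nonneg fun k _ => hnn k).1 h.symm k (Finset.mem_univ k))).symm
  · generalize ∑ k, (Y k).trace.re = t at htr h
    obtain ⟨c, hc, hcY⟩ := hsurj (fun k => (((t⁻¹ : ℝ)) : ℂ) • Y k)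
      (fun k => (hY k).smul (by exact_mod_cast (inv_pos.2 h).le)) (by
        simp only [Matrix.trace_smul, smul_eq_mul]
        rw [← Finset.mul_sum, htr, ← Complex.ofReal_mul, inv_mul_cancel₀ h.ne',
          Complex.ofReal_one])
    refine ⟨t • c, ⟨t, h.le, c, hc, rfl⟩, ?_⟩
    rw [LinearMap.map_smul_of_tower, hcY]
    ext k i j
    simp [h.ne']

/-- An element `M` of the cone that reduces to a projection is a corner of the element that
reduces to the identity. -/
theorem directSum_mul_eq_of_reduce (hC : Convex ℝ C) (hne : C.Nonempty)
    (hst : ∀ c ∈ C, IsState c) (hinj : Set.InjOn D.reduce C)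
    (hsurj : ∀ Y : D.OpA, (∀ k, (Y k).PosSemidef) → ∑ k, (Y k).trace = 1 →
      ∃ c ∈ C, D.reduce c = Y) {W M : Matrix n n ℂ} (hW : W ∈ cone C) (hW1 : D.reduce W = 1)
    {χ : D.OpA} (hχ : ∀ k, IsProj (χ k)) (hM : M ∈ cone C) (hMχ : D.reduce M = χ) :
    D.directSum χ 1 * W = M ∧ W * D.directSum χ 1 = M := by
  obtain ⟨N, hN, hNχ⟩ := cone_surjOn_reduce hne hsurj (Y := 1 - χ) fun k => (hχ k).compl.posSemidef
  have hsum : M + N = W := cone_injOn_reduce hst hinj (cone_add hC hM hN) hW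
    (by rw [map_add, hMχ, hNχ, hW1]; abel)
  have hχχ : χ * χ = χ := funext fun k => (hχ k).idem
  have hP : IsProj (D.directSum χ 1) := by
    refine ⟨?_, by rw [directSum_mul, hχχ, one_mul]⟩
    rw [Matrix.IsHermitian, conjTranspose_directSum]
    congr 1
    · exact funext fun k => (hχ k).herm.eq
    · exact funext fun k => Matrix.conjTranspose_one
  -- The weight of `M` outside χ is `tr χ - tr χ² = 0`, so positivity confines `M` to χ; likewise
  -- `N` to the complement.
  have hPM : (1 - D.directSum χ 1) * M = 0 := by
    refine hP.compl.mul_eq_zero (posSemidef_of_mem_cone hst hM) (le_of_eq ?_)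
    rw [Matrix.sub_mul, Matrix.one_mul, Matrix.trace_sub, trace_directSum_one_mul,
      ← D.sum_trace_reduce M, hMχ]
    simp [(hχ _).idem]
  have hPN : D.directSum χ 1 * N = 0 := by
    refine hP.mul_eq_zero (posSemidef_of_mem_cone hst hN) (le_of_eq ?_)
    rw [trace_directSum_one_mul, hNχ]
    simp [Matrix.mul_sub, (hχ _).idem]
  have h1 : D.directSum χ 1 * W = M := by
    rw [Matrix.sub_mul, Matrix.one_mul, sub_eq_zero] at hPM
    rw [← hsum, Matrix.mul_add, hPN, add_zero, ← hPM]
  refine ⟨h1, ?_⟩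
  have := congrArg Matrix.conjTranspose h1
  rwa [Matrix.conjTranspose_mul, (posSemidef_of_mem_cone hst hW).1.eq,
    (posSemidef_of_mem_cone hst hM).1.eq, hP.herm.eq] at this

theorem isProj_single {k : Fin D.K} {P : Matrix (Fin (D.dA k)) (Fin (D.dA k)) ℂ} (hP : IsProj P)
    (l : Fin D.K) : IsProj ((Pi.single k P : D.OpA) l) := by
  rcases eq_or_ne l k with rfl | h
  · simpa using hP
  · rw [Pi.single_eq_of_ne h]
    exact ⟨Matrix.isHermitian_zero, Matrix.mul_zero _⟩

/-- A convex set of states on which the reduction to the noiseless factors is a bijection onto all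
states of the algebra has fixed states on the noise-full factors. -/
theorem exists_eq_code (hC : Convex ℝ C) (hne : C.Nonempty)
    (hst : ∀ c ∈ C, IsState c) (hinj : Set.InjOn D.reduce C)
    (hsurj : ∀ Y : D.OpA, (∀ k, (Y k).PosSemidef) → ∑ k, (Y k).trace = 1 →
      ∃ c ∈ C, D.reduce c = Y) :
    ∃ μ : D.OpB, (∀ k, IsState (μ k)) ∧ C = D.code μ := by
  have hsurj' {Y : D.OpA} (hY : ∀ k, (Y k).PosSemidef) := cone_surjOn_reduce hne hsurj hY
  obtain ⟨W, hW, hW1⟩ := hsurj' (Y := 1) fun k => Matrix.PosSemidef.one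
  have key (k : Fin D.K) {P : Matrix (Fin (D.dA k)) (Fin (D.dA k)) ℂ} (hP : IsProj P) :
      D.directSum (Pi.single k P) 1 * W ∈ cone C ∧
      D.reduce (D.directSum (Pi.single k P) 1 * W) = Pi.single k P ∧
      D.directSum (Pi.single k P) 1 * W = W * D.directSum (Pi.single k P) 1 := by
    obtain ⟨M, hM, hMP⟩ := hsurj' fun l => (isProj_single hP l).posSemidef
    obtain ⟨h1, h2⟩ := directSum_mul_eq_of_reduce hC hne hst hinj hsurj hW hW1
      (isProj_single hP) hM hMP
    rw [h1, h2]
    exact ⟨hM, hMP, rfl⟩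
  have hherm (k : Fin D.K) {H : Matrix (Fin (D.dA k)) (Fin (D.dA k)) ℂ} (hH : H.IsHermitian) :
      D.directSum (Pi.single k H) 1 * W = W * D.directSum (Pi.single k H) 1 := by
    obtain ⟨t, P, hP, e, -⟩ := exists_spectral_projections hH
    have e' : (Pi.single k H : D.OpA) = ∑ j, t j • Pi.single k (P j) := by
      rw [e]
      simp only [← Pi.single_smul]
      exact map_sum (AddMonoidHom.single
        (fun k => Matrix (Fin (D.dA k)) (Fin (D.dA k)) ℂ) k) _ _
    rw [e', ← directSumₗ_apply, map_sum, Finset.sum_mul, Finset.mul_sum]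
    refine Finset.sum_congr rfl fun j _ => ?_
    rw [LinearMap.map_smul_of_tower, directSumₗ_apply, smul_mul_assoc, (key k (hP j)).2.2,
      mul_smul_comm]
  -- Projections span the Hermitian matrices, and a matrix unit is a complex combination of two
  -- Hermitian ones.
  have hcomm (k) (a c : Fin (D.dA k)) : D.unit k a c * W = W * D.unit k a c := by
    have h1 := hherm k (H := Matrix.single a c 1 + Matrix.single c a 1) (by
      simp [Matrix.IsHermitian, add_comm])
    have h2 := hherm k (H := Complex.I • (Matrix.single a c 1 - Matrix.single c a 1)) (by
      simp [Matrix.IsHermitian, ← smul_neg])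
    rw [Pi.single_add, ← directSumₗ_apply, map_add, Matrix.add_mul, Matrix.mul_add] at h1
    rw [Pi.single_smul, Pi.single_sub, ← directSumₗ_apply, map_smul, map_sub, Matrix.smul_mul,
      Matrix.mul_smul, Matrix.sub_mul, Matrix.mul_sub] at h2
    have h3 := smul_right_injective _ Complex.I_ne_zero h2
    have h4 := congrArg₂ (· + ·) h1 h3
    simp only [add_add_sub_cancel, ← two_smul ℂ] at h4
    exact smul_right_injective _ (two_ne_zero (α := ℂ)) h4
  obtain ⟨μ, hμ, hμpos⟩ := D.exists_eq_directSum_one hcomm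
  have hμst (k) : IsState (μ k) := by
    refine ⟨hμpos (posSemidef_of_mem_cone hst hW) k, ?_⟩
    have h1 := congrFun hW1 k
    rw [hμ, reduce_directSum] at h1
    simpa using congrFun (congrFun h1 ⟨0, D.dA_pos k⟩) ⟨0, D.dA_pos k⟩
  have hform {c} (hc : c ∈ C) : c = D.directSum (D.reduce c) μ := by
    have hps (k) := D.posSemidef_reduce (hst c hc).1 k
    choose t P hP e ht using fun k => exists_spectral_projections (hps k).1
    have e' : D.reduce c = ∑ k, ∑ j, t k j • (Pi.single k (P k j) : D.OpA) := by
      have h1 (k) : ∑ j, t k j • (Pi.single k (P k j) : D.OpA) = Pi.single k (D.reduce c k) := by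
        conv_rhs => rw [e k]
        simp only [← Pi.single_smul]
        exact (map_sum (AddMonoidHom.single
        (fun k => Matrix (Fin (D.dA k)) (Fin (D.dA k)) ℂ) k) _ _).symm
      simp only [h1]
      exact (Finset.univ_sum_single _).symm
    have h2 : D.directSum (D.reduce c) 1 * W =
        ∑ k, ∑ j, t k j • (D.directSum (Pi.single k (P k j)) 1 * W) := by
      rw [e', ← directSumₗ_apply]
      simp only [map_sum, LinearMap.map_smul_of_tower, Finset.sum_mul, smul_mul_assoc,
        directSumₗ_apply]
    -- By `h2` the right side is a nonnegative combination of corners of `W`, so it lies in the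
    -- cone; it has the same reduction as `c`.
    have h3 : c = D.directSum (D.reduce c) 1 * W := by
      rw [h2]
      refine cone_injOn_reduce hst hinj ⟨1, zero_le_one, c, hc, (one_smul _ _).symm⟩
        (cone_sum hC hne _ fun k _ => cone_sum hC hne _ fun j _ =>
          cone_smul (key k (hP k j)).1 (ht k (hps k) j)) ?_
      simp only [map_sum, LinearMap.map_smul_of_tower, (key _ (hP _ _)).2.1]
      exact e'
    conv_lhs => rw [h3, hμ, directSum_mul, mul_one, one_mul]
  refine ⟨μ, hμst, Set.Subset.antisymm (fun c hc => mem_code_of_eq hμst (hst c hc) (hform hc))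
    fun σ hσ => ?_⟩
  rw [code_eq_fixedStates hμst] at hσ
  obtain ⟨c, hc, hcσ⟩ := hsurj (D.reduce σ) (fun k => D.posSemidef_reduce hσ.1.1 k)
    (by rw [D.sum_trace_reduce, hσ.1.2])
  have : c = σ := by rw [hform hc, hcσ, ← channel_apply, hσ.2]
  exact this ▸ hc

/-- All codes of a sector decomposition with fixed states on the noise-full factors are
isometric. -/
theorem isIsometric_code {μ ν : D.OpB} (hμ : ∀ k, IsState (μ k)) (hν : ∀ k, IsState (ν k)) :
    IsIsometric (D.code μ) (D.code ν) := by
  rw [code_eq_fixedStates hμ, code_eq_fixedStates hν]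
  have hmaps {μ ν : D.OpB} (hν : ∀ k, IsState (ν k)) :
      Set.MapsTo (D.channel ν) (fixedStates (D.channel μ)) (fixedStates (D.channel ν)) :=
    fun x hx => ⟨(isPositiveTP_channel hν).isState hx.1, channel_channel hν x⟩
  have hinv {μ ν : D.OpB} (hν : ∀ k, IsState (ν k)) :
      Set.LeftInvOn (D.channel μ) (D.channel ν) (fixedStates (D.channel μ)) :=
    fun x hx => (channel_channel hν x).trans hx.2
  refine ⟨D.channel ν, Set.InvOn.bijOn ⟨hinv hν, hinv hμ⟩ (hmaps hν) (hmaps hμ),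
    fun ρ hρ σ hσ p _ => ?_⟩
  rw [convex_fixedStates.convexHull_eq] at hρ hσ
  rw [← map_weighted]
  have hx := isHermitian_weighted hρ.1.1.1 hσ.1.1.1 p (1 - p)
  have hfix : D.channel μ (p • ρ - (1 - p) • σ) = p • ρ - (1 - p) • σ := by
    rw [map_weighted, hρ.2, hσ.2]
  refine le_antisymm ((isPositiveTP_channel hν).traceNorm_le hx) ?_
  conv_lhs => rw [← hfix, ← channel_channel hν]
  exact (isPositiveTP_channel hμ).traceNorm_le ((isPositiveTP_channel hν).isHermitian hx)

/-- The states in the algebra `⨁ₖ M(Aₖ) ⊗ 1` are the code with maximally mixed noise-full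
factors. -/
theorem exists_code_eq_states_algebra (D : SectorDecomposition n) :
    ∃ ν : D.OpB, (∀ k, IsState (ν k)) ∧ D.code ν = {ρ | IsState ρ ∧ ρ ∈ D.algebra} := by
  have hd (k) : (D.dB k : ℂ) ≠ 0 := by exact_mod_cast (D.dB_pos k).ne'
  have hν (k) : IsState ((D.dB k : ℂ)⁻¹ • (1 : Matrix (Fin (D.dB k)) (Fin (D.dB k)) ℂ)) :=
    ⟨Matrix.PosSemidef.one.smul (by positivity), by simp [hd]⟩
  have e (X : D.OpA) : D.directSum X (fun k => (D.dB k : ℂ)⁻¹ • 1) =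
      D.directSum (fun k => (D.dB k : ℂ)⁻¹ • X k) fun _ => 1 := by
    simp only [directSum, Matrix.smul_kronecker, Matrix.kronecker_smul]
  refine ⟨_, hν, Set.Subset.antisymm (fun ρ hρ => ?_) ?_⟩
  · rw [code_eq_fixedStates hν] at hρ
    refine ⟨hρ.1, fun k => (D.dB k : ℂ)⁻¹ • D.reduce ρ k, ?_⟩
    exact (e _).symm.trans hρ.2
  · rintro ρ ⟨hρ, X, rfl⟩
    refine mem_code_of_eq hν hρ (X := fun k => (D.dB k : ℂ) • X k) ?_
    rw [e]
    simp [smul_smul, hd]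

end SectorDecomposition

end QInfo

end

/-- The algebra is realized as the `*`-commutant of a choice of Kraus operators. One τ-reset
recovers ergodic means for every choice of μ. -/
theorem mainTheorem4 {n : Type*} [Fintype n] [DecidableEq n]
    (E : Matrix n n ℂ →CP Matrix n n ℂ)
    (hE : QInfo.IsTracePreserving E.toLinearMap)
    (hfix : ∃ X : Matrix n n ℂ, X.rank = Fintype.card n ∧ E X = X) :
    ∃ A : StarSubalgebra ℂ (Matrix n n ℂ),
      (∀ X : Matrix n n ℂ, X ∈ A ↔ QInfo.adjointMap E.toLinearMap X = X) ∧
      (∃ D : QInfo.SectorDecomposition n, D.algebra = (A : Set (Matrix n n ℂ))) ∧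
      (∀ D : QInfo.SectorDecomposition n, D.algebra = (A : Set (Matrix n n ℂ)) →
        ∀ C : Set (Matrix n n ℂ),
          QInfo.IsMaximumNoiseless E.toLinearMap C ↔
            ∃ μ : (k : Fin D.K) → Matrix (Fin (D.dB k)) (Fin (D.dB k)) ℂ,
              (∀ k, QInfo.IsState (μ k)) ∧ C = D.code μ) ∧
      (∀ C : Set (Matrix n n ℂ), QInfo.IsMaximumNoiseless E.toLinearMap C →
        QInfo.IsIsometric C {ρ : Matrix n n ℂ | QInfo.IsState ρ ∧ ρ ∈ A}) := by
  obtain ⟨K, hK⟩ := QInfo.exists_krausMap E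
  obtain ⟨X, hr, hX⟩ := hfix
  have hX' : QInfo.krausMap K X = X := by rw [← hK]; exact hX
  rw [hK] at hE ⊢
  obtain ⟨ρ, hρ, hρfix⟩ := QInfo.exists_posDef_fixed hE hr hX'
  have hpos := QInfo.isPositiveTP_krausMap hE
  have hA (X : Matrix n n ℂ) : X ∈ StarSubalgebra.centralizer ℂ (Set.range K) ↔ _ :=
    QInfo.mem_centralizer_iff_adjoint_fixed hE hρ hρfix
  have hex := QInfo.exists_sectorDecomposition
    (A := StarSubalgebra.centralizer ℂ (Set.range K))
    fun h hh f => QInfo.cfc_mem_centralizer _ hh f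
  have hchar (D : QInfo.SectorDecomposition n)
      (hD : D.algebra = (StarSubalgebra.centralizer ℂ (Set.range K) : Set (Matrix n n ℂ)))
      (C : Set (Matrix n n ℂ)) :
      QInfo.IsMaximumNoiseless (QInfo.krausMap K) C ↔
        ∃ μ : D.OpB, (∀ k, QInfo.IsState (μ k)) ∧ C = D.code μ := by
    obtain ⟨τ, hτ, hτfix⟩ := QInfo.SectorDecomposition.exists_channel_fixed hE hρ hρfix hD
    have hred := QInfo.SectorDecomposition.reduce_map_of_adjoint_fixed
      (E := QInfo.krausMap K) (D := D) fun X => (hA _).1 (by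
        rw [← SetLike.mem_coe, ← hD]
        exact ⟨X, rfl⟩)
    have habs (μ : D.OpB) (M) : D.channel μ (QInfo.krausMap K M) = D.channel μ M := by
      rw [D.channel_apply, hred, D.channel_apply]
    have hpres {μ : D.OpB} (hμ : ∀ k, QInfo.IsState (μ k)) (C)
        (hC : QInfo.IsNoiseless (QInfo.krausMap K) C) : QInfo.IsPreserved (D.channel μ) C :=
      hC.isPreserved hpos (QInfo.SectorDecomposition.isPositiveTP_channel hμ)
        (QInfo.SectorDecomposition.isPositiveTP_channel hτ) (habs τ) hτfix
        (QInfo.SectorDecomposition.channel_channel hμ)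
    have hnl {μ : D.OpB} (hμ : ∀ k, QInfo.IsState (μ k)) :=
      QInfo.isNoiseless_fixedStates hpos
        (QInfo.SectorDecomposition.isPositiveTP_channel hμ) (habs μ)
    constructor
    · intro hC
      obtain ⟨hconv, hinj, himg⟩ := hC.image_eq
        (QInfo.SectorDecomposition.isPositiveTP_channel hτ)
        (QInfo.SectorDecomposition.channel_channel hτ) (hpres hτ) (hnl hτ)
      -- If `C` is empty, so is its image, the set of fixed states of the τ-reset, and that set is
      -- itself a code.
      rcases C.eq_empty_or_nonempty with rfl | hne
      · refine ⟨τ, hτ, ?_⟩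
        rw [QInfo.SectorDecomposition.code_eq_fixedStates hτ, ← himg, Set.image_empty]
      · refine QInfo.SectorDecomposition.exists_eq_code hconv hne hC.1.1
          (fun c hc d hd h => hinj hc hd ?_) fun Y hY htr => ?_
        · rw [D.channel_apply, h, D.channel_apply]
        · have hmem : D.directSum Y τ ∈ QInfo.fixedStates (D.channel τ) := by
            refine ⟨⟨D.posSemidef_directSum hY fun k => (hτ k).1, ?_⟩, ?_⟩
            · simpa [D.trace_directSum, (hτ _).2] using htr
            · rw [D.channel_apply, QInfo.SectorDecomposition.reduce_directSum_of_isState hτ]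
          rw [← himg] at hmem
          obtain ⟨c, hc, e⟩ := hmem
          refine ⟨c, hc, ?_⟩
          rw [← QInfo.SectorDecomposition.reduce_channel hτ, e,
            QInfo.SectorDecomposition.reduce_directSum_of_isState hτ]
    · rintro ⟨μ, hμ, rfl⟩
      rw [QInfo.SectorDecomposition.code_eq_fixedStates hμ]
      exact QInfo.isMaximumNoiseless_fixedStates
        (QInfo.SectorDecomposition.isPositiveTP_channel hμ)
        (QInfo.SectorDecomposition.channel_channel hμ) (hpres hμ) (hnl hμ)
  refine ⟨StarSubalgebra.centralizer ℂ (Set.range K), hA, hex, hchar, fun C hC => ?_⟩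
  obtain ⟨D, hD⟩ := hex
  obtain ⟨μ, hμ, rfl⟩ := (hchar D hD C).1 hC
  obtain ⟨ν, hν, e⟩ := D.exists_code_eq_states_algebra
  rw [hD] at e
  exact e ▸ QInfo.SectorDecomposition.isIsometric_code hμ hν
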